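/- Let $K$ be a non-archimedean local field with ring of integers $\mathcal{O}_K$, and let $B$ be a finite-dimensional central division algebra over $K$, with ring of integers $\mathcal{O}_B$ and uniformizer $\pi_B$. An order in $\mathbb{M}_2(B)$ is an $\mathcal{O}_K$-subalgebra (containing $1$) that is finitely generated as an $\mathcal{O}_K$-module; a maximal order is an order spanning $\mathbb{M}_2(B)$ over $K$ that is maximal for inclusion among such orders. Let $\mathfrak{T}(B)$ be the Bruhat–Tits tree of $\mathbb{M}_2(B)$: its vertices are the maximal orders in $\mathbb{M}_2(B)$, and two distinct maximal orders are neighbors if they are the endomorphism rings $\mathrm{End}_{\mathcal{O}_B}(\Lambda)$, $\mathrm{End}_{\mathcal{O}_B}(\Lambda')$ of right $\mathcal{O}_B$-lattices $\Lambda,\Lambda'\subseteq B^2$ with $\Lambda\pi_B\subsetneq\Lambda'\subsetneq\Lambda$. For an order $\mathfrak{H}$, the branch $\mathfrak{S}(\mathfrak{H})$ is the maximal subgraph of $\mathfrak{T}(B)$ whose vertices are the maximal orders containing $\mathfrak{H}$; a subgraph of this form is called an admissible branch. Let $\mathfrak{D}$ be a maximal order in $\mathbb{M}_2(B)$ and let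 $t\geq 0$ be an integer. Then $\mathfrak{D}$ has a unique maximal two-sided ideal $\mathcal{M}_{\mathfrak{D}}$. Let $\mathfrak{B}$ be the ball of radius $t$ in $\mathfrak{T}(B)$ centered at $\mathfrak{D}$, i.e. the largest subgraph containing no vertex at distance larger than $t$ from $\mathfrak{D}$. Then $\mathfrak{B}$ is an admissible branch, and the intersection of all the maximal orders that are vertices of $\mathfrak{B}$ is $$\bigcap_{\mathfrak{D}'\in V(\mathfrak{B})}\mathfrak{D}'=\mathfrak{D}^{[t]}:=\{x\in\mathfrak{D}\;:\;\bar{x}\in Z(\mathfrak{D}/\mathcal{M}_{\mathfrak{D}}^t)\},$$ where $\bar{x}$ is the image of $x$ in $\mathfrak{D}/\mathcal{M}_{\mathfrak{D}}^t$ and $Z(R)$ denotes the center of the ring $R$ (with $\mathcal{M}_{\mathfrak{D}}^0=\mathfrak{D}$). -/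

import Mathlib

open scoped ValuativeRel

namespace BTTree

section Algebra

variable (K : Type*) [Field K] [ValuativeRel K] (B : Type*) [DivisionRing B] [Algebra K B]

/-- The ring of integers of the division algebra `B`: the elements integral over `𝒪[K]`. -/
def integers : Set B := {b | IsIntegral 𝒪[K] b}

/-- The maximal ideal `𝔪_B` of the ring of integers of `B`: its non-units. -/
def maxIdeal : Set B := {b | b ∈ integers K B ∧ ¬ ∃ c ∈ integers K B, b * c = 1}

variable {K B}

/-- A (not necessarily full) `𝒪[K]`-order in `M₂(B)`: a subring containing `𝒪[K]` that is a finitely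
generated `𝒪[K]`-module. -/
def IsOrder (H : Subalgebra 𝒪[K] (Matrix (Fin 2) (Fin 2) B)) : Prop :=
  (Subalgebra.toSubmodule H).FG

/-- An order of maximal rank: it spans `M₂(B)` over `K`. -/
def IsFullOrder (H : Subalgebra 𝒪[K] (Matrix (Fin 2) (Fin 2) B)) : Prop :=
  IsOrder H ∧ Submodule.span K (H : Set (Matrix (Fin 2) (Fin 2) B)) = ⊤

/-- A maximal order in `M₂(B)`. -/
def IsMaximalOrder (D : Subalgebra 𝒪[K] (Matrix (Fin 2) (Fin 2) B)) : Prop :=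
  Maximal IsFullOrder D

/-- A right lattice over the ring of integers of `B`, in the space `B²` of column vectors, on which
matrices act on the left and the scalars of `B` act on the right. -/
structure IsLattice (L : Submodule 𝒪[K] (Fin 2 → B)) : Prop where
  fg : L.FG
  span_eq_top : Submodule.span K (L : Set (Fin 2 → B)) = ⊤
  mul_mem : ∀ v ∈ L, ∀ b ∈ integers K B, MulOpposite.op b • v ∈ L

/-- `L 𝔪_B`, that is `L π_B` for any uniformizer `π_B` of `B`. -/
noncomputable def latticeMulMaxIdeal (L : Submodule 𝒪[K] (Fin 2 → B)) : Submodule 𝒪[K] (Fin 2 → B) :=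
  Submodule.span 𝒪[K] {w | ∃ v ∈ L, ∃ b ∈ maxIdeal K B, w = MulOpposite.op b • v}

/-- The order `D` is the endomorphism ring of the lattice `L`. -/
def IsEndOf (D : Subalgebra 𝒪[K] (Matrix (Fin 2) (Fin 2) B))
    (L : Submodule 𝒪[K] (Fin 2 → B)) : Prop :=
  ∀ A : Matrix (Fin 2) (Fin 2) B, A ∈ D ↔ ∀ v ∈ L, A.mulVec v ∈ L

variable (K B)

/-- The vertices of the Bruhat–Tits tree: the maximal orders in `M₂(B)`. -/
abbrev Vertex : Type _ :=
  {D : Subalgebra 𝒪[K] (Matrix (Fin 2) (Fin 2) B) // IsMaximalOrder D}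

/-- The Bruhat–Tits tree `𝔗(B)`: two maximal orders are neighbors when they are the endomorphism
rings of two lattices `L`, `L'` with `L π_B ⊊ L' ⊊ L`. -/
def tree : SimpleGraph (Vertex K B) :=
  SimpleGraph.fromRel fun D D' =>
    ∃ L L' : Submodule 𝒪[K] (Fin 2 → B), IsLattice L ∧ IsLattice L' ∧
      IsEndOf D.1 L ∧ IsEndOf D'.1 L' ∧ latticeMulMaxIdeal L < L' ∧ L' < L

variable {K B}

/-- The branch `𝔖(H)`: the maximal subgraph of the tree whose vertices are the maximal orders
containing `H`. -/
def branch (H : Subalgebra 𝒪[K] (Matrix (Fin 2) (Fin 2) B)) : (tree K B).Subgraph :=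
  (⊤ : (tree K B).Subgraph).induce {D | H ≤ D.1}

/-- A subgraph of the tree is an admissible branch if it is the branch of some order. -/
def IsAdmissible (S : (tree K B).Subgraph) : Prop :=
  ∃ H : Subalgebra 𝒪[K] (Matrix (Fin 2) (Fin 2) B), IsOrder H ∧ S = branch H

/-- The intersection of all the maximal orders that are vertices of a subgraph. -/
noncomputable def intersectionOrder (S : (tree K B).Subgraph) :
    Subalgebra 𝒪[K] (Matrix (Fin 2) (Fin 2) B) :=
  ⨅ D ∈ S.verts, D.1

/-- The closed ball of radius `t` about `D`: the largest subgraph of the tree with no vertex at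
distance larger than `t` from `D`. -/
def closedBall (D : Vertex K B) (t : ℕ) : (tree K B).Subgraph :=
  (⊤ : (tree K B).Subgraph).induce {D' | (tree K B).edist D D' ≤ t}

end Algebra

section Bilateral

/-- `I` is a maximal (proper) bilateral ideal of the ring `R`. -/
def IsMaximalBilateral {R : Type*} [Ring R] (I : Ideal R) : Prop :=
  Maximal (fun J : Ideal R => J.IsTwoSided ∧ J ≠ ⊤) I

/-- The intersection of the maximal bilateral ideals of `R`; this is the maximal bilateral ideal
whenever `R` has exactly one. -/
def maximalBilateral (R : Type*) [Ring R] : Ideal R :=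
  sInf {I | IsMaximalBilateral I}

instance maximalBilateral_isTwoSided (R : Type*) [Ring R] : (maximalBilateral R).IsTwoSided where
  mul_mem_of_left b ha := by
    rw [maximalBilateral, Submodule.mem_sInf] at ha ⊢
    intro I hI
    have := hI.1.1
    exact Ideal.mul_mem_right b I (ha I hI)

end Bilateral

variable {K : Type*} [Field K] [ValuativeRel K] {B : Type*} [DivisionRing B] [Algebra K B]

/-- `D^{[t]}`: the elements of `D` whose image in `D / M_D ^ t` is central, where `M_D` is the
maximal bilateral ideal of `D`. -/
def bracket (D : Subalgebra 𝒪[K] (Matrix (Fin 2) (Fin 2) B)) (t : ℕ) :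
    Set (Matrix (Fin 2) (Fin 2) B) :=
  {x | ∃ hx : x ∈ D, Ideal.Quotient.mk (maximalBilateral D ^ t) ⟨x, hx⟩ ∈
    Subring.center (D ⧸ maximalBilateral D ^ t)}

end BTTree

/-! Everything rests on a discrete valuation `v` of `B` whose valuation ring is 𝒪_B, namely `x ↦
|N(x)|`, where `N` is the determinant of left multiplication. Local compactness of `K` makes `{|N| ≤
1}` bounded, and this identifies it with the set of integral elements. With a uniformizer π,
elimination shows that every lattice is g𝒪_B² (`exists_eq_lat`) and every maximal order is
gM₂(𝒪_B)g⁻¹ (`exists_eq_ord`). The Cartan decomposition gives h = g k diag(πˢ, 1) b l, with k, l in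
GL₂(𝒪_B) and b scalar, so that the vertex of h is at distance at most s from that of g.

Put y = g⁻¹xg. The ideal M_D is gπM₂(𝒪_B)g⁻¹ and its t-th power is gπᵗM₂(𝒪_B)g⁻¹, so x lies in
D^{[t]} exactly when y is integral and its commutators with integral matrices are divisible by πᵗ
(`mem_bracket_iff`).

If x lies in every order of the ball, then it lies in those of the vertices g k diag(πᵗ, 1), so the
upper right corner of k⁻¹yk is divisible by πᵗ for every k in GL₂(𝒪_B); `matLE_commutator` turns
this into the commutator condition. Conversely, a vertex within distance t has a representative g'
such that m = g⁻¹g' is integral and πᵗ clears the denominators of m⁻¹; then g'⁻¹xg' = m⁻¹(ym - my) +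
y is integral.

The ball is the branch of this intersection: the intersection contains gπᵗM₂(𝒪_B)g⁻¹, and an order
in relative position s containing that set has s ≤ t (`le_of_forall_mem_ord`). -/

namespace BTTree

open ValuativeRel

/-! ### Elements of norm at most 1 are integral, by compactness. -/

section LocalField

variable {K : Type*} [Field K] [ValuativeRel K] {B : Type*} [DivisionRing B] [Algebra K B]

theorem integer_smul_def {M : Type*} [AddCommGroup M] [Module K M] (c : 𝒪[K]) (b : M) :
    c • b = (c : K) • b := rfl

theorem exists_forall_mul_mem_integer {ι : Type*} [Finite ι] (f : ι → K) :
    ∃ c : K, c ≠ 0 ∧ ∀ i, valuation K (c * f i) ≤ 1 := by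
  classical
  suffices H : ∀ s : Set ι, s.Finite → ∃ c : K, c ≠ 0 ∧ ∀ i ∈ s, valuation K (c * f i) ≤ 1 by
    obtain ⟨c, hc, h⟩ := H Set.univ Set.finite_univ
    exact ⟨c, hc, fun i => h i trivial⟩
  intro s hs
  induction s, hs using Set.Finite.induction_on with
  | empty => exact ⟨1, one_ne_zero, by simp⟩
  | @insert a s _ _ ih =>
    obtain ⟨c, hc, h⟩ := ih
    by_cases ha : valuation K (c * f a) ≤ 1
    · refine ⟨c, hc, ?_⟩
      rintro i (rfl | hi)
      exacts [ha, h i hi]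
    · have h0 : c * f a ≠ 0 := by rintro h0; simp [h0] at ha
      refine ⟨(c * f a)⁻¹ * c, mul_ne_zero (inv_ne_zero h0) hc, ?_⟩
      rintro i (rfl | hi)
      · rw [mul_assoc, inv_mul_cancel₀ h0, map_one]
      · rw [mul_assoc, map_mul, map_inv₀]
        exact mul_le_one' (inv_le_one_of_one_le₀ (not_le.mp ha).le) (h i hi)

theorem continuous_norm_sum_smul {K : Type*} [Field K] {B : Type*} [DivisionRing B] [Algebra K B]
    [FiniteDimensional K B] [TopologicalSpace K] [IsTopologicalRing K] {ι : Type*} [Fintype ι]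
    (m : ι → B) : Continuous fun x : ι → K => Algebra.norm K (∑ i, x i • m i) := by
  let b := Module.finBasis K B
  have : (fun x : ι → K => Algebra.norm K (∑ i, x i • m i)) =
      fun x => (∑ i, x i • Algebra.leftMulMatrix b (m i)).det := by
    funext x
    rw [Algebra.norm_eq_matrix_det b, map_sum]
    simp only [map_smul]
  rw [this]
  refine Continuous.matrix_det ?_
  fun_prop

variable [FiniteDimensional K B] [TopologicalSpace K] [IsNonarchimedeanLocalField K]

/-- Integral vectors with some coordinate equal to 1 form a compact set. The norm is continuous and
does not vanish there, as `B` is a division algebra, so its image is closed and misses a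
neighbourhood of 0. -/
theorem exists_le_valuation_norm {ι : Type*} [Fintype ι] (b : Module.Basis ι K B) :
    ∃ γ : ValueGroupWithZero K, γ ≠ 0 ∧ ∀ x : ι → K, (∀ i, valuation K (x i) ≤ 1) →
      (∃ i, x i = 1) → γ ≤ valuation K (Algebra.norm K (∑ i, x i • b i)) := by
  classical
  let S : Set (ι → K) := ⋃ i, Set.univ.pi fun j =>
    if j = i then {1} else {x : K | valuation K x ≤ 1}
  have hS : IsCompact S := by
    refine isCompact_iUnion fun i => isCompact_univ_pi fun j => ?_
    split_ifs
    · exact isCompact_singleton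
    · exact IsNonarchimedeanLocalField.isCompact_closedBall K 1
  have hT2 : T2Space K := by
    let := IsTopologicalAddGroup.rightUniformSpace K
    have := isUniformAddGroup_of_addCommGroup (G := K)
    infer_instance
  have hc := (hS.image (continuous_norm_sum_smul (K := K) b)).isClosed
  have h0 : (0 : K) ∈ ((fun x : ι → K => Algebra.norm K (∑ i, x i • b i)) '' S)ᶜ := by
    rintro ⟨x, hx, hx0⟩
    simp only [Algebra.norm_eq_zero_iff] at hx0
    obtain ⟨i, hi⟩ := Set.mem_iUnion.mp hx
    have h1 := hi i trivial
    simp only [if_true, Set.mem_singleton_iff] at h1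
    have := (Fintype.linearIndependent_iff.mp b.linearIndependent) x hx0 i
    simp [h1] at this
  obtain ⟨γ, hγ, h⟩ := (IsValuativeTopology.hasBasis_nhds_zero' K).mem_iff.mp
    (hc.isOpen_compl.mem_nhds h0)
  refine ⟨γ, hγ, fun x hx ⟨i, hi⟩ => ?_⟩
  by_contra! hlt
  refine h (show Algebra.norm K (∑ i, x i • b i) ∈ _ from hlt)
    ⟨x, Set.mem_iUnion.mpr ⟨i, fun j _ => ?_⟩, rfl⟩
  dsimp only
  split_ifs with hj
  · rw [hj, hi]; rfl
  · exact hx j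

theorem exists_fg_of_valuation_norm_le_one : ∃ M : Submodule 𝒪[K] B, M.FG ∧
    ∀ x : B, valuation K (Algebra.norm K x) ≤ 1 → x ∈ M := by
  classical
  let b := Module.finBasis K B
  obtain ⟨γ, hγ, h⟩ := exists_le_valuation_norm b
  -- Dividing `x` by its largest coordinate ξ yields γ|ξ|ⁿ ≤ |N(x)| ≤ 1, with n the dimension of
  -- `B`. Hence |ξ| ≤ 1, or |ξ| ≤ |ξ|ⁿ ≤ γ⁻¹.
  obtain ⟨c, hc⟩ := valuation_surjective (max 1 γ⁻¹)
  have hc0 : c ≠ 0 := by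
    rintro rfl
    rw [map_zero] at hc
    exact absurd (le_max_left 1 γ⁻¹) (by rw [← hc]; simp)
  refine ⟨Submodule.span 𝒪[K] (Set.range fun i => c • b i),
    Submodule.fg_span (Set.finite_range _), fun x hx => ?_⟩
  suffices hb : ∀ i, valuation K (b.repr x i) ≤ valuation K c by
    rw [← b.sum_repr x]
    refine Submodule.sum_mem _ fun i _ => ?_
    have hm : valuation K (b.repr x i * c⁻¹) ≤ 1 := by
      rw [map_mul, map_inv₀]
      exact mul_inv_le_one_of_le₀ (hb i) zero_le
    have : b.repr x i • b i = (⟨b.repr x i * c⁻¹, hm⟩ : 𝒪[K]) • c • b i := by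
      rw [integer_smul_def, smul_smul, inv_mul_cancel_right₀ hc0]
    rw [this]
    exact Submodule.smul_mem _ _ (Submodule.subset_span ⟨i, rfl⟩)
  intro j
  have : Nonempty (Fin (Module.finrank K B)) := ⟨j⟩
  obtain ⟨i, hi⟩ := Finite.exists_max fun i => valuation K (b.repr x i)
  refine (hi j).trans ?_
  by_cases h0 : b.repr x i = 0
  · simp [h0]
  let y : Fin (Module.finrank K B) → K := fun j => (b.repr x i)⁻¹ * b.repr x j
  have hy := h y (fun j => by
    simp only [y, map_mul, map_inv₀]
    exact inv_mul_le_one_of_le₀ (hi j) zero_le) ⟨i, inv_mul_cancel₀ h0⟩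
  have hxy : x = b.repr x i • ∑ j, y j • b j := by
    simp only [y, mul_smul, ← Finset.smul_sum, smul_inv_smul₀ h0]
    exact (b.sum_repr x).symm
  rw [hxy, Algebra.smul_def, map_mul, Algebra.norm_algebraMap, map_mul, map_pow] at hx
  rw [hc]
  have h2 : valuation K (b.repr x i) ^ Module.finrank K B ≤ γ⁻¹ := by
    rw [← one_div, le_div_iff₀ (zero_lt_iff.mpr hγ)]
    exact (mul_le_mul_right hy _).trans hx
  rcases le_total (valuation K (b.repr x i)) 1 with h1 | h1
  · exact h1.trans (le_max_left _ _)
  · exact ((le_self_pow₀ h1 (Module.finrank_pos (R := K) (M := B)).ne').trans h2).trans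
      (le_max_right _ _)

/-- All powers of `x` have norm at most 1, so 𝒪[K][x] sits in a Noetherian module and is finitely
generated. -/
theorem isIntegral_of_valuation_norm_le_one {x : B} (hx : valuation K (Algebra.norm K x) ≤ 1) :
    IsIntegral 𝒪[K] x := by
  obtain ⟨M, hM, h⟩ := exists_fg_of_valuation_norm_le_one (K := K) (B := B)
  have hle : Subalgebra.toSubmodule (Algebra.adjoin 𝒪[K] {x}) ≤ M := by
    rw [Algebra.adjoin_singleton_eq_range_aeval]
    rintro _ ⟨p, rfl⟩
    simp only [AlgHom.toRingHom_eq_coe, RingHom.coe_coe]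
    rw [Polynomial.aeval_eq_sum_range]
    refine Submodule.sum_mem _ fun i _ => Submodule.smul_mem _ _ (h _ ?_)
    rw [map_pow, map_pow]
    exact pow_le_one' hx i
  have : IsNoetherian 𝒪[K] M := isNoetherian_of_fg_of_noetherian M hM
  exact IsIntegral.of_mem_of_fg _ (Submodule.FG.of_le hM hle) x
    (Algebra.self_mem_adjoin_singleton _ x)

end LocalField

/-- `v` is a discrete valuation of `B` with uniformizer `π`, whose valuation ring is the ring of
integers of `B`, contained in a finitely generated `𝒪[K]`-module. -/
structure IsIntegerValuation (K : Type*) [Field K] [ValuativeRel K] {B : Type*} [DivisionRing B]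
    [Algebra K B] {Γ : Type*} [LinearOrderedCommGroupWithZero Γ] (v : Valuation B Γ) (π : B) :
    Prop where
  mem_integers : ∀ b, b ∈ integers K B ↔ v b ≤ 1
  ne_zero : π ≠ 0
  lt_one : v π < 1
  exists_zpow : ∀ b, b ≠ 0 → ∃ k : ℤ, v b = v π ^ k
  exists_fg : ∃ M : Submodule 𝒪[K] B, M.FG ∧ ∀ b, v b ≤ 1 → b ∈ M
  exists_smul : ∀ b, ∃ c : 𝒪[K], c ≠ 0 ∧ v (c • b) ≤ 1

/-! ### The norm valuation of `B` and its uniformizer. -/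

section LocalField

variable {K : Type*} [Field K] [ValuativeRel K] {B : Type*} [DivisionRing B] [Algebra K B]
  [FiniteDimensional K B] [TopologicalSpace K] [IsNonarchimedeanLocalField K]

theorem isIntegral_integer_iff {K : Type*} [Field K] [ValuativeRel K] {x : K} :
    IsIntegral 𝒪[K] x ↔ valuation K x ≤ 1 := by
  refine ⟨fun h => ?_, fun h => isIntegral_algebraMap (x := (⟨x, h⟩ : 𝒪[K]))⟩
  have := (Valuation.integer.integers (valuation K)).mem_of_integral h
  exact this

/-- Since 𝒪[K][x] is finitely generated, a single `c` clears the denominators of the matrices of all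
powers of `x`. Taking determinants, the powers of |N(x)| stay bounded, which forces |N(x)| ≤ 1 in an
archimedean value group. -/
theorem valuation_norm_le_one_of_isIntegral {x : B} (hx : IsIntegral 𝒪[K] x) :
    valuation K (Algebra.norm K x) ≤ 1 := by
  let b := Module.finBasis K B
  obtain ⟨s, hs⟩ := hx.fg_adjoin_singleton
  obtain ⟨c, hc, h⟩ := exists_forall_mul_mem_integer
    fun p : ↥s × Fin (Module.finrank K B) × Fin (Module.finrank K B) =>
      Algebra.leftMulMatrix b (p.1 : B) p.2.1 p.2.2
  have hmem : ∀ y ∈ Algebra.adjoin 𝒪[K] {x}, ∀ i j,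
      valuation K (c * Algebra.leftMulMatrix b y i j) ≤ 1 := by
    intro y hy i j
    rw [← Subalgebra.mem_toSubmodule, ← hs] at hy
    induction hy using Submodule.span_induction with
    | mem y hy => exact h ⟨⟨y, hy⟩, i, j⟩
    | zero => simp
    | add y z _ _ hy hz =>
      rw [map_add, Matrix.add_apply, mul_add]
      exact (valuation K).map_add_le hy hz
    | smul a y _ hy =>
      rw [integer_smul_def, map_smul, Matrix.smul_apply, smul_eq_mul, mul_left_comm, map_mul]
      exact mul_le_one' a.2 hy
  have hpow : ∀ k : ℕ, valuation K (c ^ Module.finrank K B) * valuation K (Algebra.norm K x) ^ k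
      ≤ 1 := by
    intro k
    rw [← map_pow, ← map_pow, ← map_mul, Algebra.norm_eq_matrix_det b]
    conv_lhs =>
      rw [show c ^ Module.finrank K B = c ^ Fintype.card (Fin (Module.finrank K B)) by simp]
    rw [← Matrix.det_smul, ← isIntegral_integer_iff]
    refine IsIntegral.det fun i j => isIntegral_integer_iff.mpr ?_
    exact hmem _ (pow_mem (Algebra.self_mem_adjoin_singleton _ x) k) i j
  by_contra! h1
  obtain ⟨k, hk⟩ := MulArchimedean.arch (valuation K (c ^ Module.finrank K B))⁻¹ h1
  have h3 : (1 : ValueGroupWithZero K) ≤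
      valuation K (c ^ Module.finrank K B) * valuation K (Algebra.norm K x) ^ k := by
    rwa [inv_le_iff_one_le_mul₀' (zero_lt_iff.mpr (by simp [hc]))] at hk
  have h4 := hpow (k + 1)
  rw [pow_succ, ← mul_assoc] at h4
  exact absurd (h4.trans h3) (not_le.mpr (lt_mul_of_one_lt_right (zero_lt_one.trans_le h3) h1))

theorem isIntegral_iff_valuation_norm_le_one {x : B} :
    IsIntegral 𝒪[K] x ↔ valuation K (Algebra.norm K x) ≤ 1 :=
  ⟨valuation_norm_le_one_of_isIntegral, isIntegral_of_valuation_norm_le_one⟩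

variable (K B) in
/-- The valuation `x ↦ |N(x)|` of the division algebra `B`. -/
noncomputable def normValuation : Valuation B (ValueGroupWithZero K) :=
  { toFun := fun x => valuation K (Algebra.norm K x)
    map_zero' := by rw [Algebra.norm_zero, map_zero]
    map_one' := by rw [map_one, map_one]
    map_mul' := fun x y => by rw [map_mul, map_mul]
    map_add_le_max' := by
      -- After division by `x`, only sums 1 + z with z integral remain. These lie in the commutative
      -- ring 𝒪[K][z], so no sum of noncommuting integral elements has to be handled.
      have key : ∀ x y : B, valuation K (Algebra.norm K y) ≤ valuation K (Algebra.norm K x) →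
          valuation K (Algebra.norm K (x + y)) ≤ valuation K (Algebra.norm K x) := by
        intro x y hxy
        by_cases hx : x = 0
        · rw [hx, Algebra.norm_zero, map_zero, le_zero_iff, map_eq_zero,
            Algebra.norm_eq_zero_iff] at hxy
          rw [hxy, add_zero]
        have h1 : x + y = x * (1 + x⁻¹ * y) := by rw [mul_add, mul_one, mul_inv_cancel_left₀ hx]
        have h2 : valuation K (Algebra.norm K (x⁻¹ * y)) ≤ 1 := by
          have h3 := congrArg (fun z => valuation K (Algebra.norm K z)) (mul_inv_cancel₀ hx)
          simp only [map_mul, map_one] at h3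
          rw [map_mul, map_mul, eq_inv_of_mul_eq_one_right h3]
          exact inv_mul_le_one_of_le₀ hxy zero_le
        have h3 : valuation K (Algebra.norm K (1 + x⁻¹ * y)) ≤ 1 := by
          rw [← isIntegral_iff_valuation_norm_le_one] at h2 ⊢
          exact IsIntegral.of_mem_of_fg _ h2.fg_adjoin_singleton _
            (add_mem (one_mem _) (Algebra.self_mem_adjoin_singleton _ _))
        rw [h1, map_mul, map_mul]
        exact mul_le_of_le_one_right' h3
      intro x y
      rcases le_total (valuation K (Algebra.norm K y)) (valuation K (Algebra.norm K x)) with h | h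
      · exact (key x y h).trans (le_max_left _ _)
      · rw [add_comm]
        exact (key y x h).trans (le_max_right _ _) }

theorem normValuation_apply (x : B) :
    normValuation K B x = valuation K (Algebra.norm K x) := rfl

variable (K B) in
-- The values of `Bˣ` form a subgroup of a cyclic group, nontrivial because N(r) = rⁿ for r in `K`.
-- A generator or its inverse has value less than 1 and serves as uniformizer.
theorem exists_isIntegerValuation : ∃ π : B, IsIntegerValuation K (normValuation K B) π := by
  let f : Bˣ →* (ValueGroupWithZero K)ˣ := Units.map (normValuation K B : B →* ValueGroupWithZero K)
  obtain ⟨⟨_, ⟨p, rfl⟩⟩, hp⟩ := IsCyclic.exists_generator (α := f.range)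
  have hp' : ∀ b : B, b ≠ 0 → ∃ k : ℤ, normValuation K B b = normValuation K B p ^ k := by
    intro b hb
    obtain ⟨k, hk⟩ := Subgroup.mem_zpowers_iff.mp (hp ⟨f (Units.mk0 b hb), _, rfl⟩)
    refine ⟨k, ?_⟩
    have := congrArg (fun z : f.range => ((z : (ValueGroupWithZero K)ˣ) : ValueGroupWithZero K)) hk
    simpa [f] using this.symm
  have hne : normValuation K B p ≠ 1 := by
    intro h1
    obtain ⟨r, hr0, hr⟩ := Valuation.IsNontrivial.exists_lt_one (v := valuation K)
    have hr0' : r ≠ 0 := by simpa using hr0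
    obtain ⟨k, hk⟩ := hp' (algebraMap K B r) (by simpa using hr0')
    rw [h1, one_zpow, normValuation_apply, Algebra.norm_algebraMap, map_pow] at hk
    exact absurd hk (pow_lt_one₀ zero_le hr (Module.finrank_pos (R := K) (M := B)).ne').ne
  obtain ⟨M, hM, hM'⟩ := exists_fg_of_valuation_norm_le_one (K := K) (B := B)
  have hsmul : ∀ b : B, ∃ c : 𝒪[K], c ≠ 0 ∧ normValuation K B (c • b) ≤ 1 := by
    intro b
    rcases le_or_gt (normValuation K B b) 1 with h | h
    · exact ⟨1, one_ne_zero, by rwa [one_smul]⟩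
    · obtain ⟨c, hc⟩ := valuation_surjective (normValuation K B b)⁻¹
      have hc1 : valuation K c ≤ 1 := hc ▸ inv_le_one_of_one_le₀ h.le
      have h0 : normValuation K B b ≠ 0 := (zero_lt_one.trans h).ne'
      refine ⟨⟨c, hc1⟩, fun hc0 => ?_, ?_⟩
      · have hc0' : c = 0 := congrArg Subtype.val hc0
        rw [hc0', map_zero] at hc
        exact inv_ne_zero h0 hc.symm
      · rw [integer_smul_def, Algebra.smul_def, map_mul, normValuation_apply (algebraMap K B c),
          Algebra.norm_algebraMap, map_pow]
        refine (mul_le_mul_left (pow_le_of_le_one zero_le hc1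
          (Module.finrank_pos (R := K) (M := B)).ne') _).trans ?_
        rw [hc, inv_mul_cancel₀ h0]
  rcases lt_or_gt_of_ne hne with h | h
  · exact ⟨p, fun b => isIntegral_iff_valuation_norm_le_one, p.ne_zero, h, hp', ⟨M, hM, hM'⟩, hsmul⟩
  · refine ⟨(p : B)⁻¹, fun b => isIntegral_iff_valuation_norm_le_one, inv_ne_zero p.ne_zero,
      ?_, fun b hb => ?_, ⟨M, hM, hM'⟩, hsmul⟩
    · rw [map_inv₀]
      exact inv_lt_one_of_one_lt₀ h
    · obtain ⟨k, hk⟩ := hp' b hb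
      exact ⟨-k, by rw [hk, map_inv₀, inv_zpow, zpow_neg, inv_inv]⟩

end LocalField

/-! ### Integral matrices and the Cartan decomposition of GL₂(B). -/

section Matrices

variable {B : Type*} [DivisionRing B] {Γ : Type*} [LinearOrderedCommGroupWithZero Γ]
  (v : Valuation B Γ)

/-- All the entries of the matrix `x` have valuation at most `γ`. -/
def MatLE (γ : Γ) (x : Matrix (Fin 2) (Fin 2) B) : Prop := ∀ i j, v (x i j) ≤ γ

variable {v} {γ δ : Γ} {x y : Matrix (Fin 2) (Fin 2) B}

theorem MatLE.mono (h : MatLE v γ x) (hγ : γ ≤ δ) : MatLE v δ x := fun i j => (h i j).trans hγ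

theorem MatLE.add (hx : MatLE v γ x) (hy : MatLE v γ y) : MatLE v γ (x + y) :=
  fun i j => v.map_add_le (hx i j) (hy i j)

theorem MatLE.sub (hx : MatLE v γ x) (hy : MatLE v γ y) : MatLE v γ (x - y) :=
  fun i j => v.map_sub_le (hx i j) (hy i j)

theorem MatLE.mul (hx : MatLE v γ x) (hy : MatLE v δ y) : MatLE v (γ * δ) (x * y) := by
  intro i j
  rw [Matrix.mul_apply]
  refine v.map_sum_le fun k _ => ?_
  rw [map_mul]
  exact mul_le_mul' (hx i k) (hy k j)

theorem MatLE.mul_of_le (hx : MatLE v γ x) (hy : MatLE v δ y) {ε : Γ} (h : γ * δ ≤ ε) :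
    MatLE v ε (x * y) := (hx.mul hy).mono h

theorem matLE_zero : MatLE v γ 0 := fun i j => by simp

theorem matLE_one : MatLE v 1 1 := fun i j => by
  rw [Matrix.one_apply]
  split_ifs <;> simp

theorem matLE_of {a b c d : B} (ha : v a ≤ γ) (hb : v b ≤ γ) (hc : v c ≤ γ) (hd : v d ≤ γ) :
    MatLE v γ !![a, b; c, d] := by
  intro i j
  fin_cases i <;> fin_cases j <;> simpa

theorem matLE_scalar {b : B} (hb : v b ≤ γ) : MatLE v γ (Matrix.scalar (Fin 2) b) := by
  intro i j
  rw [Matrix.scalar_apply, Matrix.diagonal_apply]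
  split_ifs <;> simp [hb]

theorem matLE_single {b : B} (hb : v b ≤ γ) (i j : Fin 2) : MatLE v γ (Matrix.single i j b) := by
  intro k l
  rw [Matrix.single_apply]
  split_ifs <;> simp [hb]

variable (v) in
/-- The matrix `k` is integral together with its inverse. -/
def IntegralUnit (k : (Matrix (Fin 2) (Fin 2) B)ˣ) : Prop := MatLE v 1 ↑k ∧ MatLE v 1 ↑k⁻¹

theorem integralUnit_one : IntegralUnit v 1 := ⟨by simpa using matLE_one, by simpa using matLE_one⟩

theorem IntegralUnit.mul {k l : (Matrix (Fin 2) (Fin 2) B)ˣ} (hk : IntegralUnit v k)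
    (hl : IntegralUnit v l) : IntegralUnit v (k * l) := by
  refine ⟨?_, ?_⟩
  · rw [Units.val_mul]
    exact hk.1.mul_of_le hl.1 (by simp)
  · rw [mul_inv_rev, Units.val_mul]
    exact hl.2.mul_of_le hk.2 (by simp)

/-- The scalar matrix of a nonzero element. -/
def scalarUnit (b : Bˣ) : (Matrix (Fin 2) (Fin 2) B)ˣ :=
  Units.map (Matrix.scalar (Fin 2)).toMonoidHom b

theorem scalarUnit_val (b : Bˣ) : (scalarUnit b : Matrix (Fin 2) (Fin 2) B) =
    Matrix.scalar (Fin 2) (b : B) := rfl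

theorem scalarUnit_inv (b : Bˣ) : (scalarUnit b)⁻¹ = scalarUnit b⁻¹ :=
  rfl

/-- The diagonal matrix with entries `a` and `1`. -/
def diagUnit (a : Bˣ) : (Matrix (Fin 2) (Fin 2) B)ˣ where
  val := !![(a : B), 0; 0, 1]
  inv := !![((a⁻¹ : Bˣ) : B), 0; 0, 1]
  val_inv := by simp [Matrix.one_fin_two]
  inv_val := by simp [Matrix.one_fin_two]

/-- The upper triangular unipotent matrix with corner `b`. -/
def upperUnit (b : B) : (Matrix (Fin 2) (Fin 2) B)ˣ where
  val := !![1, b; 0, 1]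
  inv := !![1, -b; 0, 1]
  val_inv := by simp [Matrix.one_fin_two]
  inv_val := by simp [Matrix.one_fin_two]

variable (B) in
/-- The permutation matrix exchanging the two coordinates. -/
def swapUnit : (Matrix (Fin 2) (Fin 2) B)ˣ where
  val := !![0, 1; 1, 0]
  inv := !![0, 1; 1, 0]
  val_inv := by simp [Matrix.one_fin_two]
  inv_val := by simp [Matrix.one_fin_two]

theorem integralUnit_upperUnit {b : B} (hb : v b ≤ 1) : IntegralUnit v (upperUnit b) :=
  ⟨matLE_of (by simp) hb (by simp) (by simp),
    matLE_of (by simp) (by rwa [Valuation.map_neg]) (by simp) (by simp)⟩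

theorem integralUnit_swapUnit : IntegralUnit v (swapUnit B) :=
  ⟨matLE_of (by simp) (by simp) (by simp) (by simp),
    matLE_of (by simp) (by simp) (by simp) (by simp)⟩

theorem integralUnit_diagUnit {a : Bˣ} (ha : v a = 1) : IntegralUnit v (diagUnit a) :=
  ⟨matLE_of ha.le (by simp) (by simp) (by simp),
    matLE_of (by rw [Units.val_inv_eq_inv_val, map_inv₀, ha, inv_one]) (by simp) (by simp)
      (by simp)⟩

theorem diagUnit_mul (a b : Bˣ) : diagUnit (a * b) = diagUnit a * diagUnit b := by
  ext1
  simp [diagUnit]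

theorem diagUnit_pow (a : Bˣ) (n : ℕ) : diagUnit (a ^ n) = diagUnit a ^ n := by
  induction n with
  | zero =>
    ext1
    simp [diagUnit, Matrix.one_fin_two]
  | succ n ih => rw [pow_succ, pow_succ, diagUnit_mul, ih]

theorem matLE_scalarUnit_mul_iff {b : Bˣ} {x : Matrix (Fin 2) (Fin 2) B} :
    MatLE v γ (scalarUnit b * x) ↔ MatLE v ((v b)⁻¹ * γ) x := by
  refine forall₂_congr fun i j => ?_
  have h0 : v (b : B) ≠ 0 := by simp
  rw [scalarUnit_val, Matrix.scalar_apply, Matrix.diagonal_mul, map_mul,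
    le_inv_mul_iff₀ (zero_lt_iff.mpr h0)]

theorem matLE_mul_scalarUnit_iff {b : Bˣ} {x : Matrix (Fin 2) (Fin 2) B} :
    MatLE v γ (x * scalarUnit b) ↔ MatLE v ((v b)⁻¹ * γ) x := by
  refine forall₂_congr fun i j => ?_
  have h0 : v (b : B) ≠ 0 := by simp
  rw [scalarUnit_val, Matrix.scalar_apply, Matrix.mul_diagonal, map_mul,
    le_inv_mul_iff₀ (zero_lt_iff.mpr h0), mul_comm]

/-- A scalar matrix need not be central, but the value group is commutative, so conjugation by it
preserves the valuation of each entry. -/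
theorem matLE_scalarUnit_conj_iff {b : Bˣ} {x : Matrix (Fin 2) (Fin 2) B} :
    MatLE v γ ((scalarUnit b)⁻¹.val * x * (scalarUnit b).val) ↔ MatLE v γ x := by
  rw [matLE_mul_scalarUnit_iff, scalarUnit_inv, matLE_scalarUnit_mul_iff,
    Units.val_inv_eq_inv_val, map_inv₀, inv_inv, mul_inv_cancel_left₀ (by simp)]

theorem IntegralUnit.matLE_conj_iff {k : (Matrix (Fin 2) (Fin 2) B)ˣ} (hk : IntegralUnit v k)
    {x : Matrix (Fin 2) (Fin 2) B} : MatLE v γ (k⁻¹.val * x * k.val) ↔ MatLE v γ x := by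
  refine ⟨fun h => ?_, fun h => (hk.2.mul h).mul_of_le hk.1 (by simp)⟩
  have := (hk.1.mul h).mul_of_le (δ := 1) (ε := γ) hk.2 (by simp)
  simpa [mul_assoc] using this

/-- The factorization of an invertible matrix whose lower right entry has the largest valuation. -/
theorem exists_eq_upper_mul_diagonal (x : (Matrix (Fin 2) (Fin 2) B)ˣ)
    (h : MatLE v (v (x.val 1 1)) x) : ∃ k l : (Matrix (Fin 2) (Fin 2) B)ˣ, ∃ a b : Bˣ,
      IntegralUnit v k ∧ IntegralUnit v l ∧ v a ≤ 1 ∧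
        x = k * diagUnit a * scalarUnit b * l := by
  set d := x.val 1 1 with hd
  have hd0 : d ≠ 0 := by
    intro h0
    have hx : x.val = 0 := by
      ext i j
      have := h i j
      rw [h0, map_zero, le_zero_iff, map_eq_zero] at this
      exact this
    exact x.ne_zero hx
  -- The Schur complement of `d`. As `d` has the largest valuation, the elimination matrices are
  -- integral and `e * d⁻¹` has valuation at most 1.
  set e := x.val 0 0 - x.val 0 1 * d⁻¹ * x.val 1 0 with he
  have hl : ∀ c, v (x.val c 1 * d⁻¹) ≤ 1 := fun c => by
    rw [map_mul, map_inv₀]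
    exact mul_inv_le_one_of_le₀ (h c 1) zero_le
  have hr : ∀ c, v (d⁻¹ * x.val 1 c) ≤ 1 := fun c => by
    rw [map_mul, map_inv₀]
    exact inv_mul_le_one_of_le₀ (h 1 c) zero_le
  let k := upperUnit (x.val 0 1 * d⁻¹)
  let l := swapUnit B * upperUnit (d⁻¹ * x.val 1 0) * swapUnit B
  have hfac : x.val = k * !![e, 0; 0, d] * l := by
    simp only [k, l, upperUnit, swapUnit, Units.val_mul, Matrix.mul_fin_two]
    rw [Matrix.eta_fin_two x.val]
    congr 1
    simp [he, ← hd, hd0, mul_assoc]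
  have he0 : e ≠ 0 := by
    intro h0
    have h1 : !![e, 0; 0, d] * (l.val * (x⁻¹).val * k.val) = 1 := by
      have : !![e, 0; 0, d] = (k⁻¹).val * x.val * (l⁻¹).val := by
        rw [hfac]; simp [mul_assoc]
      rw [this]; simp [mul_assoc]
    have h2 := congrFun (congrFun h1 0) 0
    rw [Matrix.mul_apply] at h2
    simp [h0] at h2
  refine ⟨k, l, Units.mk0 (e * d⁻¹) (mul_ne_zero he0 (inv_ne_zero hd0)), Units.mk0 d hd0,
    integralUnit_upperUnit (hl 0),
    (integralUnit_swapUnit.mul (integralUnit_upperUnit (hr 0))).mul integralUnit_swapUnit, ?_, ?_⟩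
  · rw [Units.val_mk0, map_mul, map_inv₀]
    refine mul_inv_le_one_of_le₀ (v.map_sub_le (h 0 0) ?_) zero_le
    rw [map_mul]
    exact mul_le_of_le_one_of_le (hl 0) (h 1 0)
  · ext1
    have : (diagUnit (Units.mk0 (e * d⁻¹) (mul_ne_zero he0 (inv_ne_zero hd0)))).val *
        (scalarUnit (Units.mk0 d hd0)).val = !![e, 0; 0, d] := by
      rw [scalarUnit_val, Matrix.scalar_apply]
      simp [diagUnit, Matrix.diagonal_fin_two, hd0]
    rw [hfac, ← this, Units.val_mul _ l, Units.val_mul _ (scalarUnit _), Units.val_mul k,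
      ← mul_assoc k.val]

theorem exists_eq_integral_mul_diagonal (x : (Matrix (Fin 2) (Fin 2) B)ˣ) :
    ∃ k l : (Matrix (Fin 2) (Fin 2) B)ˣ, ∃ a b : Bˣ,
      IntegralUnit v k ∧ IntegralUnit v l ∧ v a ≤ 1 ∧
        x = k * diagUnit a * scalarUnit b * l := by
  obtain ⟨⟨i, j⟩, hij⟩ := Finite.exists_max fun p : Fin 2 × Fin 2 => v (x.val p.1 p.2)
  -- Permutations of the rows, and below of the columns, bring the largest entry to the lower right
  -- corner. The second clause records that rows are only rearranged, so the entry remains the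
  -- largest.
  obtain ⟨p, hp, hp'⟩ : ∃ p, IntegralUnit v p ∧ ∀ m : Matrix (Fin 2) (Fin 2) B,
      (p.val * m) 1 = m i ∧ ∀ c, ∃ c', (p.val * m) c = m c' := by
    fin_cases i
    · refine ⟨swapUnit B, integralUnit_swapUnit, fun m => ⟨?_, fun c => ⟨1 - c, ?_⟩⟩⟩
      · ext j; simp [swapUnit, Matrix.mul_apply]
      · ext j; fin_cases c <;> simp [swapUnit, Matrix.mul_apply]
    · exact ⟨1, integralUnit_one, fun m => ⟨by simp, fun c => ⟨c, by simp⟩⟩⟩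
  obtain ⟨q, hq, hq'⟩ : ∃ q, IntegralUnit v q ∧ ∀ m : Matrix (Fin 2) (Fin 2) B,
      (∀ c, (m * q.val) c 1 = m c j) ∧ ∀ r, ∃ r', ∀ c, (m * q.val) c r = m c r' := by
    fin_cases j
    · refine ⟨swapUnit B, integralUnit_swapUnit, fun m => ⟨fun c => ?_, fun r => ⟨1 - r, fun c => ?_⟩⟩⟩
      · simp [swapUnit, Matrix.mul_apply]
      · fin_cases r <;> simp [swapUnit, Matrix.mul_apply]
    · exact ⟨1, integralUnit_one, fun m => ⟨by simp, fun c => ⟨c, by simp⟩⟩⟩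
  obtain ⟨k, l, a, b, hk, hl, ha, h⟩ := exists_eq_upper_mul_diagonal (v := v) (p * x * q) (by
    intro c r
    rw [Units.val_mul, (hq' _).1, Units.val_mul, (hp' _).1]
    obtain ⟨r', hr'⟩ := (hq' (p.val * x.val)).2 r
    obtain ⟨c', hc'⟩ := (hp' x.val).2 c
    rw [hr', hc']
    exact hij (c', r'))
  refine ⟨p⁻¹ * k, l * q⁻¹, a, b, ?_, ?_, ha, ?_⟩
  · exact IntegralUnit.mul ⟨hp.2, by simpa using hp.1⟩ hk
  · exact hl.mul ⟨hq.2, by simpa using hq.1⟩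
  · have : x = p⁻¹ * (p * x * q) * q⁻¹ := by group
    rw [this, h]; group

end Matrices

/-! ### The lattices g𝒪_B² and the orders gM₂(𝒪_B)g⁻¹. -/

section Orders

variable {K : Type*} [Field K] [ValuativeRel K] {B : Type*} [DivisionRing B] [Algebra K B]
  {Γ : Type*} [LinearOrderedCommGroupWithZero Γ] {v : Valuation B Γ} {π : B}

namespace IsIntegerValuation

theorem val_pos (hv : IsIntegerValuation K v π) : 0 < v π :=
  zero_lt_iff.mpr (by simpa using hv.ne_zero)

theorem map_smul_le (hv : IsIntegerValuation K v π) (c : 𝒪[K]) (b : B) : v (c • b) ≤ v b := by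
  rw [Algebra.smul_def, map_mul]
  exact mul_le_of_le_one_left' ((hv.mem_integers _).mp isIntegral_algebraMap)

theorem exists_pow (hv : IsIntegerValuation K v π) {b : B} (hb : b ≠ 0) (h : v b ≤ 1) :
    ∃ s : ℕ, v b = v π ^ s := by
  obtain ⟨k, hk⟩ := hv.exists_zpow b hb
  rw [hk, zpow_le_one_iff_right_of_lt_one₀ hv.val_pos hv.lt_one] at h
  lift k to ℕ using h
  exact ⟨k, by rw [hk, zpow_natCast]⟩

theorem le_of_lt_one (hv : IsIntegerValuation K v π) {b : B} (h : v b < 1) : v b ≤ v π := by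
  by_cases hb : b = 0
  · simp [hb]
  obtain ⟨s, hs⟩ := hv.exists_pow hb h.le
  rw [hs]
  refine pow_le_of_le_one zero_le hv.lt_one.le ?_
  rintro rfl
  simp [hs] at h

theorem mem_maxIdeal_iff (hv : IsIntegerValuation K v π) {b : B} :
    b ∈ maxIdeal K B ↔ v b < 1 := by
  simp only [maxIdeal, Set.mem_ofPred_eq, hv.mem_integers]
  refine ⟨fun ⟨h, h'⟩ => lt_of_le_of_ne h fun h1 => h' ⟨b⁻¹, ?_, ?_⟩, fun h => ⟨h.le, ?_⟩⟩
  · rw [map_inv₀, h1, inv_one]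
  · exact mul_inv_cancel₀ (by rintro rfl; simp at h1)
  · rintro ⟨c, hc, hbc⟩
    have := congrArg v hbc
    rw [map_mul, map_one] at this
    exact absurd this (mul_lt_one_of_lt_of_le h hc).ne

/-- The valuation is discrete: a largest value is a least exponent of `v π`, and the exponents are
bounded below by `m`. -/
theorem exists_max (hv : IsIntegerValuation K v π) {S : Set B} (h0 : ∃ x ∈ S, x ≠ 0) {m : ℤ}
    (hm : ∀ x ∈ S, v x ≤ v π ^ m) : ∃ x ∈ S, x ≠ 0 ∧ ∀ y ∈ S, v y ≤ v x := by
  obtain ⟨x₀, hx₀, hx₀'⟩ := h0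
  obtain ⟨k₀, hk₀⟩ := hv.exists_zpow x₀ hx₀'
  obtain ⟨k, ⟨x, hx, hx0, hxk⟩, hk⟩ := Int.exists_least_of_bdd
    (P := fun k => ∃ x ∈ S, x ≠ 0 ∧ v x = v π ^ k)
    ⟨m, fun k ⟨x, hx, _, hxk⟩ => by
      have := hm x hx
      rwa [hxk, zpow_le_zpow_iff_right_of_lt_one₀ hv.val_pos hv.lt_one] at this⟩
    ⟨k₀, x₀, hx₀, hx₀', hk₀⟩
  refine ⟨x, hx, hx0, fun y hy => ?_⟩
  by_cases hy0 : y = 0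
  · simp [hy0]
  obtain ⟨l, hl⟩ := hv.exists_zpow y hy0
  rw [hl, hxk, zpow_le_zpow_iff_right_of_lt_one₀ hv.val_pos hv.lt_one]
  exact hk l ⟨y, hy, hy0, hl⟩

theorem exists_smul_forall (hv : IsIntegerValuation K v π) {ι : Type*} [Finite ι] (f : ι → B) :
    ∃ c : 𝒪[K], c ≠ 0 ∧ ∀ i, v (c • f i) ≤ 1 := by
  classical
  have := Fintype.ofFinite ι
  choose c hc hc' using fun i => hv.exists_smul (f i)
  refine ⟨∏ i, c i, Finset.prod_ne_zero_iff.mpr fun i _ => hc i, fun i => ?_⟩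
  rw [← Finset.prod_erase_mul _ _ (Finset.mem_univ i), mul_smul]
  exact (hv.map_smul_le _ _).trans (hc' i)

/-- The lattice `g 𝒪_B²`. -/
def lat (hv : IsIntegerValuation K v π) (g : (Matrix (Fin 2) (Fin 2) B)ˣ) :
    Submodule 𝒪[K] (Fin 2 → B) where
  carrier := {w | ∀ i, v ((g⁻¹.val.mulVec w) i) ≤ 1}
  add_mem' hx hy i := by
    rw [Matrix.mulVec_add]
    exact v.map_add_le (hx i) (hy i)
  zero_mem' i := by simp
  smul_mem' c w hw i := by
    rw [Matrix.mulVec_smul]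
    exact (hv.map_smul_le _ _).trans (hw i)

theorem mem_lat (hv : IsIntegerValuation K v π) {g : (Matrix (Fin 2) (Fin 2) B)ˣ} {w : Fin 2 → B} :
    w ∈ hv.lat g ↔ ∀ i, v ((g⁻¹.val.mulVec w) i) ≤ 1 := Iff.rfl

/-- The order `g M₂(𝒪_B) g⁻¹`. -/
def ord (hv : IsIntegerValuation K v π) (g : (Matrix (Fin 2) (Fin 2) B)ˣ) :
    Subalgebra 𝒪[K] (Matrix (Fin 2) (Fin 2) B) where
  carrier := {x | MatLE v 1 (g⁻¹.val * x * g.val)}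
  add_mem' {x y} hx hy := by
    simp only [Set.mem_ofPred_eq, mul_add, add_mul] at *
    exact hx.add hy
  mul_mem' {x y} hx hy := by
    have := hx.mul_of_le (ε := 1) hy (by simp)
    simpa [mul_assoc] using this
  algebraMap_mem' c := by
    have h : g⁻¹.val * algebraMap 𝒪[K] _ c * g.val = algebraMap 𝒪[K] _ c := by
      rw [mul_assoc, Algebra.commutes, ← mul_assoc, Units.inv_mul, one_mul]
    simp only [Set.mem_ofPred_eq, h]
    exact matLE_scalar ((hv.mem_integers _).mp isIntegral_algebraMap)

theorem mem_ord (hv : IsIntegerValuation K v π) {g : (Matrix (Fin 2) (Fin 2) B)ˣ}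
    {x : Matrix (Fin 2) (Fin 2) B} : x ∈ hv.ord g ↔ MatLE v 1 (g⁻¹.val * x * g.val) := Iff.rfl

theorem mulVec_le {x : Matrix (Fin 2) (Fin 2) B} (hx : MatLE v 1 x) {w : Fin 2 → B}
    (hw : ∀ i, v (w i) ≤ 1) (i : Fin 2) : v ((x.mulVec w) i) ≤ 1 := by
  rw [Matrix.mulVec, dotProduct]
  refine v.map_sum_le fun j _ => ?_
  rw [map_mul]
  exact mul_le_one' (hx i j) (hw j)

theorem single_le (i j : Fin 2) : v ((Pi.single i 1 : Fin 2 → B) j) ≤ 1 := by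
  rw [Pi.single_apply]
  split_ifs <;> simp

theorem mulVec_single_one_apply (x : Matrix (Fin 2) (Fin 2) B) (i j : Fin 2) :
    (x.mulVec (Pi.single j 1)) i = x i j := by
  rw [Matrix.mulVec_single_one, Matrix.col_apply]

theorem mulVec_single_mem_lat (hv : IsIntegerValuation K v π) (g : (Matrix (Fin 2) (Fin 2) B)ˣ)
    (j : Fin 2) : g.val.mulVec (Pi.single j 1) ∈ hv.lat g := by
  intro i
  rw [Matrix.mulVec_mulVec, Units.inv_mul, Matrix.one_mulVec]
  exact single_le j i

theorem lat_le_lat_iff (hv : IsIntegerValuation K v π) {g h : (Matrix (Fin 2) (Fin 2) B)ˣ} :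
    hv.lat g ≤ hv.lat h ↔ MatLE v 1 (h⁻¹.val * g.val) := by
  refine ⟨fun H i j => ?_, fun H w hw i => ?_⟩
  · have := H (hv.mulVec_single_mem_lat g j) i
    rwa [Matrix.mulVec_mulVec, mulVec_single_one_apply] at this
  · have := mulVec_le H hw i
    rwa [Matrix.mulVec_mulVec, mul_assoc, Units.mul_inv, mul_one] at this

theorem isEndOf_lat (hv : IsIntegerValuation K v π) (g : (Matrix (Fin 2) (Fin 2) B)ˣ) :
    IsEndOf (hv.ord g) (hv.lat g) := by
  intro A
  refine ⟨fun H w hw i => ?_, fun H i j => ?_⟩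
  · have := mulVec_le H hw i
    rwa [Matrix.mulVec_mulVec, mul_assoc, Units.mul_inv, mul_one, ← Matrix.mulVec_mulVec] at this
  · have := H _ (hv.mulVec_single_mem_lat g j) i
    rwa [Matrix.mulVec_mulVec, Matrix.mulVec_mulVec, mulVec_single_one_apply] at this

theorem eq_ord_of_isEndOf (hv : IsIntegerValuation K v π) {g : (Matrix (Fin 2) (Fin 2) B)ˣ}
    {D : Subalgebra 𝒪[K] (Matrix (Fin 2) (Fin 2) B)} (h : IsEndOf D (hv.lat g)) :
    D = hv.ord g := by
  ext A
  rw [h A, hv.isEndOf_lat g A]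

theorem fg_of_le_one (hv : IsIntegerValuation K v π) {ι M : Type*} [Finite ι] [AddCommGroup M]
    [Module 𝒪[K] M] [IsNoetherianRing 𝒪[K]] (f : (ι → B) →ₗ[𝒪[K]] M) (L : Submodule 𝒪[K] M)
    (h : ∀ x ∈ L, ∃ w : ι → B, (∀ i, v (w i) ≤ 1) ∧ f w = x) : L.FG := by
  obtain ⟨N, hN, hN'⟩ := hv.exists_fg
  have h1 : ((Submodule.pi Set.univ fun _ : ι => N).map f).FG :=
    (Submodule.fg_pi fun _ => hN).map f
  have : IsNoetherian 𝒪[K] _ := isNoetherian_of_fg_of_noetherian _ h1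
  refine Submodule.FG.of_le h1 fun x hx => ?_
  obtain ⟨w, hw, rfl⟩ := h x hx
  exact ⟨w, fun i _ => hN' _ (hw i), rfl⟩

theorem span_eq_top_of_exists_smul {M : Type*} [AddCommGroup M] [Module K M]
    {S : Submodule 𝒪[K] M} (h : ∀ x : M, ∃ c : 𝒪[K], c ≠ 0 ∧ c • x ∈ S) :
    Submodule.span K (S : Set M) = ⊤ := by
  rw [eq_top_iff]
  rintro x -
  obtain ⟨c, hc, hx⟩ := h x
  have hc' : (c : K) ≠ 0 := by simpa using hc
  rw [← inv_smul_smul₀ hc' x]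
  exact Submodule.smul_mem _ _ (Submodule.subset_span hx)

theorem exists_smul_of_span_eq_top {M : Type*} [AddCommGroup M] [Module K M]
    {S : Submodule 𝒪[K] M} (h : Submodule.span K (S : Set M) = ⊤) (x : M) :
    ∃ c : 𝒪[K], c ≠ 0 ∧ c • x ∈ S := by
  have hx : x ∈ Submodule.span K (S : Set M) := h ▸ trivial
  induction hx using Submodule.span_induction with
  | mem x hx => exact ⟨1, one_ne_zero, by rwa [one_smul]⟩
  | zero => exact ⟨1, one_ne_zero, by simp⟩
  | add x y _ _ hx hy =>
    obtain ⟨c, hc, hcx⟩ := hx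
    obtain ⟨d, hd, hdy⟩ := hy
    refine ⟨c * d, mul_ne_zero hc hd, ?_⟩
    rw [smul_add, mul_smul c d y, mul_comm, mul_smul d c x]
    exact add_mem (S.smul_mem _ hcx) (S.smul_mem _ hdy)
  | smul a x _ hx =>
    obtain ⟨c, hc, hcx⟩ := hx
    -- Either `a` is integral, or its inverse is and can be absorbed in the denominator.
    rcases le_total (valuation K a) 1 with ha | ha
    · refine ⟨c, hc, ?_⟩
      have : c • a • x = (⟨a, ha⟩ : 𝒪[K]) • c • x := by
        simp only [integer_smul_def, smul_smul, mul_comm]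
      rw [this]
      exact S.smul_mem _ hcx
    · have ha0 : a ≠ 0 := by rintro rfl; simp at ha
      have ha' : valuation K a⁻¹ ≤ 1 := by
        rw [map_inv₀]
        exact inv_le_one_of_one_le₀ ha
      refine ⟨c * ⟨a⁻¹, ha'⟩, mul_ne_zero hc fun h => ?_, ?_⟩
      · exact inv_ne_zero ha0 (congrArg Subtype.val h)
      · have : (c * ⟨a⁻¹, ha'⟩) • a • x = c • x := by
          simp only [integer_smul_def, smul_smul, Subring.coe_mul]
          rw [inv_mul_cancel_right₀ ha0]
        rwa [this]

/-- The embedding `b ↦ g b g⁻¹` of `B` in the matrices. -/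
def conjScalar (g : (Matrix (Fin 2) (Fin 2) B)ˣ) : B →ₐ[𝒪[K]] Matrix (Fin 2) (Fin 2) B where
  toFun b := g.val * Matrix.scalar (Fin 2) b * g⁻¹.val
  map_one' := by simp
  map_mul' a b := by rw [map_mul]; simp only [mul_assoc, Units.inv_mul_cancel_left]
  map_zero' := by simp
  map_add' a b := by rw [map_add, mul_add, add_mul]
  commutes' c := by
    have : Matrix.scalar (Fin 2) (algebraMap 𝒪[K] B c) = algebraMap 𝒪[K] _ c := rfl
    rw [this, mul_assoc, Algebra.commutes, ← mul_assoc, Units.mul_inv, one_mul]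

theorem conjScalar_injective (g : (Matrix (Fin 2) (Fin 2) B)ˣ) :
    Function.Injective (conjScalar (K := K) g) := by
  intro a b h
  have h' : g.val * Matrix.scalar (Fin 2) a * g⁻¹.val = g.val * Matrix.scalar (Fin 2) b * g⁻¹.val := h
  rw [Units.mul_left_inj, Units.mul_right_inj] at h'
  exact Matrix.scalar_inj.mp h'

variable [IsNoetherianRing 𝒪[K]]

theorem isLattice_lat (hv : IsIntegerValuation K v π) (g : (Matrix (Fin 2) (Fin 2) B)ˣ) :
    IsLattice (hv.lat g) where
  fg := by
    refine hv.fg_of_le_one (ι := Fin 2)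
      { toFun := fun w => g.val.mulVec w
        map_add' := fun w w' => Matrix.mulVec_add _ _ _
        map_smul' := fun c w => Matrix.mulVec_smul _ _ _ } _ fun w hw => ⟨_, hw, ?_⟩
    change g.val.mulVec (g⁻¹.val.mulVec w) = w
    rw [Matrix.mulVec_mulVec, Units.mul_inv, Matrix.one_mulVec]
  span_eq_top := by
    refine span_eq_top_of_exists_smul fun w => ?_
    obtain ⟨c, hc, h⟩ := hv.exists_smul_forall (g⁻¹.val.mulVec w)
    refine ⟨c, hc, fun i => ?_⟩
    rw [Matrix.mulVec_smul]
    exact h i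
  mul_mem := by
    intro w hw b hb i
    rw [Matrix.mulVec_smul, Pi.smul_apply, MulOpposite.smul_eq_mul_unop, map_mul]
    exact mul_le_one' (hw i) ((hv.mem_integers b).mp hb)

theorem isFullOrder_ord (hv : IsIntegerValuation K v π) (g : (Matrix (Fin 2) (Fin 2) B)ˣ) :
    IsFullOrder (hv.ord g) := by
  refine ⟨?_, ?_⟩
  · refine hv.fg_of_le_one (ι := Fin 2 × Fin 2)
      { toFun := fun w => g.val * Matrix.of (fun i j => w (i, j)) * g⁻¹.val
        map_add' := fun w w' => ?_
        map_smul' := fun c w => ?_ } _ fun x hx =>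
          ⟨fun p => (g⁻¹.val * x * g.val) p.1 p.2, fun p => hx p.1 p.2, ?_⟩
    · rw [← add_mul, ← mul_add]; rfl
    · rw [RingHom.id_apply, ← smul_mul_assoc, ← mul_smul_comm]; rfl
    · change g.val * (g⁻¹.val * x * g.val) * g⁻¹.val = x
      simp [mul_assoc]
  · refine span_eq_top_of_exists_smul (S := Subalgebra.toSubmodule (hv.ord g)) fun x => ?_
    obtain ⟨c, hc, h⟩ := hv.exists_smul_forall
      fun p : Fin 2 × Fin 2 => (g⁻¹.val * x * g.val) p.1 p.2
    refine ⟨c, hc, fun i j => ?_⟩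
    rw [mul_smul_comm, smul_mul_assoc]
    exact h (i, j)

/-- A larger order contains the conjugated matrix units. These move any entry b of g⁻¹Ag onto the
diagonal, so the order contains the image of b under `conjScalar`. That image is integral, hence so
is b. -/
theorem isMaximalOrder_ord (hv : IsIntegerValuation K v π) (g : (Matrix (Fin 2) (Fin 2) B)ˣ) :
    IsMaximalOrder (hv.ord g) := by
  refine ⟨hv.isFullOrder_ord g, fun H hH hle A hA => ?_⟩
  rw [mem_ord]
  intro i j
  have hs : ∀ k l : Fin 2, g.val * Matrix.single k l 1 * g⁻¹.val ∈ H := fun k l => by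
    refine hle ?_
    rw [mem_ord]
    simpa [mul_assoc] using matLE_single (v := v) (b := 1) (by simp) k l
  set x := g⁻¹.val * A * g.val with hx
  have hk : ∀ k : Fin 2, g.val * Matrix.single k k (x i j) * g⁻¹.val ∈ H := fun k => by
    have h1 : Matrix.single k k (x i j) = Matrix.single k i 1 * x * Matrix.single j k 1 := by
      simp
    have h2 : g.val * Matrix.single k k (x i j) * g⁻¹.val =
        g.val * Matrix.single k i 1 * g⁻¹.val * A * (g.val * Matrix.single j k 1 * g⁻¹.val) := by
      rw [h1, hx]
      simp only [mul_assoc]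
    rw [h2]
    exact mul_mem (mul_mem (hs _ _) hA) (hs _ _)
  have hmem : conjScalar (K := K) g (x i j) ∈ H := by
    have : Matrix.scalar (Fin 2) (x i j) =
        Matrix.single 0 0 (x i j) + Matrix.single 1 1 (x i j) := by
      ext a b
      fin_cases a <;> fin_cases b <;> simp
    change g.val * Matrix.scalar (Fin 2) (x i j) * g⁻¹.val ∈ H
    rw [this, mul_add, add_mul]
    exact add_mem (hk 0) (hk 1)
  rw [← hv.mem_integers]
  exact (isIntegral_algHom_iff _ (conjScalar_injective g)).mp
    (IsIntegral.of_mem_of_fg H hH.1 _ hmem)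

end IsIntegerValuation

end Orders

/-! ### Every lattice is free and every maximal order is a conjugate of M₂(𝒪_B). -/

section Lattices

variable {K : Type*} [Field K] [ValuativeRel K] {B : Type*} [DivisionRing B] [Algebra K B]
  {Γ : Type*} [LinearOrderedCommGroupWithZero Γ] {v : Valuation B Γ} {π : B}

namespace IsIntegerValuation

theorem exists_bound_of_fg (hv : IsIntegerValuation K v π) {L : Submodule 𝒪[K] (Fin 2 → B)}
    (hL : L.FG) : ∃ m : ℤ, ∀ w ∈ L, ∀ i, v (w i) ≤ v π ^ m := by
  have hanti : ∀ {m n : ℤ}, m ≤ n → v π ^ n ≤ v π ^ m := fun h =>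
    (zpow_le_zpow_iff_right_of_lt_one₀ hv.val_pos hv.lt_one).mpr h
  have hb : ∀ b : B, ∃ m : ℤ, v b ≤ v π ^ m := fun b => by
    by_cases h : b = 0
    · exact ⟨0, by simp [h]⟩
    · obtain ⟨k, hk⟩ := hv.exists_zpow b h
      exact ⟨k, hk.le⟩
  induction L, hL using Submodule.fg_induction with
  | singleton x =>
    obtain ⟨m, hm⟩ := hb (x 0)
    obtain ⟨n, hn⟩ := hb (x 1)
    refine ⟨min m n, fun w hw i => ?_⟩
    obtain ⟨c, rfl⟩ := Submodule.mem_span_singleton.mp hw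
    refine (hv.map_smul_le _ _).trans ?_
    fin_cases i
    · exact hm.trans (hanti (min_le_left _ _))
    · exact hn.trans (hanti (min_le_right _ _))
  | sup L L' _ _ hL hL' =>
    obtain ⟨m, hm⟩ := hL
    obtain ⟨n, hn⟩ := hL'
    refine ⟨min m n, fun w hw i => ?_⟩
    obtain ⟨a, ha, b, hb, rfl⟩ := Submodule.mem_sup.mp hw
    exact v.map_add_le ((hm a ha i).trans (hanti (min_le_left _ _)))
      ((hn b hb i).trans (hanti (min_le_right _ _)))

/-- The invertible lower triangular matrix with the given entries. -/
def lowerUnit (a b : Bˣ) (c : B) : (Matrix (Fin 2) (Fin 2) B)ˣ where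
  val := !![(a : B), 0; c, b]
  inv := !![(a⁻¹ : Bˣ), 0; -((b⁻¹ : Bˣ) : B) * c * (a⁻¹ : Bˣ), (b⁻¹ : Bˣ)]
  val_inv := by simp [Matrix.one_fin_two, mul_assoc]
  inv_val := by simp [Matrix.one_fin_two, mul_assoc]

theorem lowerUnit_inv_val (a b : Bˣ) (c : B) : (lowerUnit a b c)⁻¹.val =
    !![((a⁻¹ : Bˣ) : B), 0; -((b⁻¹ : Bˣ) : B) * c * (a⁻¹ : Bˣ), ((b⁻¹ : Bˣ) : B)] := rfl

/-- Elimination over 𝒪_B. Take `u` in `L` whose first coordinate `a` has the largest valuation, and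
(0, b) in `L` with `b` of largest valuation; these two vectors form a right 𝒪_B-basis of `L`, and
they are the columns of the matrix `g`. -/
theorem exists_eq_lat (hv : IsIntegerValuation K v π) {L : Submodule 𝒪[K] (Fin 2 → B)}
    (hL : IsLattice L) : ∃ g : (Matrix (Fin 2) (Fin 2) B)ˣ, L = hv.lat g := by
  obtain ⟨m, hm⟩ := hv.exists_bound_of_fg hL.fg
  have hne : ∀ (c : 𝒪[K]), c ≠ 0 → c • (1 : B) ≠ 0 := by
    intro c hc h
    rw [integer_smul_def, smul_eq_zero] at h
    simp [hc] at h
  obtain ⟨a, ⟨u, hu, hua⟩, ha0, ha⟩ := hv.exists_max (S := {b | ∃ w ∈ L, w 0 = b}) (m := m) (by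
      obtain ⟨c, hc, h⟩ := exists_smul_of_span_eq_top hL.span_eq_top (fun _ => 1)
      exact ⟨c • 1, ⟨_, h, rfl⟩, hne c hc⟩) (by
      rintro _ ⟨w, hw, rfl⟩
      exact hm w hw 0)
  obtain ⟨b, hbL, hb0, hb⟩ := hv.exists_max (S := {b | ![0, b] ∈ L}) (m := m) (by
      obtain ⟨c, hc, h⟩ := exists_smul_of_span_eq_top hL.span_eq_top ![(0 : B), 1]
      refine ⟨c • 1, ?_, hne c hc⟩
      have : c • ![(0 : B), 1] = ![0, c • 1] := by
        ext i
        fin_cases i <;> simp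
      rwa [this] at h) (by
      intro x hx
      exact hm _ hx 1)
  refine ⟨lowerUnit (Units.mk0 a ha0) (Units.mk0 b hb0) (u 1), ?_⟩
  have hcoord : ∀ w : Fin 2 → B, w ∈ hv.lat (lowerUnit (Units.mk0 a ha0) (Units.mk0 b hb0) (u 1)) ↔
      v (a⁻¹ * w 0) ≤ 1 ∧ v (b⁻¹ * (w 1 - u 1 * (a⁻¹ * w 0))) ≤ 1 := by
    intro w
    rw [mem_lat, lowerUnit_inv_val, Fin.forall_fin_two]
    simp [mul_sub, mul_assoc, neg_add_eq_sub, Matrix.vecHead, Matrix.vecTail]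
  have hdec : ∀ w : Fin 2 → B, w = MulOpposite.op (a⁻¹ * w 0) • u +
      ![0, w 1 - u 1 * (a⁻¹ * w 0)] := by
    intro w
    ext i
    fin_cases i
    · simp [hua, ha0]
    · simp
  ext w
  rw [hcoord]
  constructor
  · intro hw
    have h1 : v (a⁻¹ * w 0) ≤ 1 := by
      rw [map_mul, map_inv₀]
      exact inv_mul_le_one_of_le₀ (ha _ ⟨w, hw, rfl⟩) zero_le
    refine ⟨h1, ?_⟩
    have h2 : ![0, w 1 - u 1 * (a⁻¹ * w 0)] ∈ L := by
      rw [eq_sub_iff_add_eq'.mpr (hdec w).symm]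
      exact sub_mem hw (hL.mul_mem u hu _ ((hv.mem_integers _).mpr h1))
    rw [map_mul, map_inv₀]
    exact inv_mul_le_one_of_le₀ (hb _ h2) zero_le
  · rintro ⟨h1, h2⟩
    rw [hdec w]
    refine add_mem (hL.mul_mem u hu _ ((hv.mem_integers _).mpr h1)) ?_
    have := hL.mul_mem _ hbL _ ((hv.mem_integers _).mpr h2)
    convert this using 1
    ext i
    fin_cases i
    · simp
    · simp [hb0]

/-- The lattice D·𝒪_B² is stable under `D`, so `D` is contained in its endomorphism ring; maximality
gives equality. -/
theorem exists_eq_ord [IsNoetherianRing 𝒪[K]] (hv : IsIntegerValuation K v π)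
    {D : Subalgebra 𝒪[K] (Matrix (Fin 2) (Fin 2) B)} (hD : IsMaximalOrder D) :
    ∃ g : (Matrix (Fin 2) (Fin 2) B)ˣ, D = hv.ord g := by
  let f : Matrix (Fin 2) (Fin 2) B →ₗ[𝒪[K]] (Fin 2 → B) →ₗ[𝒪[K]] (Fin 2 → B) :=
    LinearMap.mk₂ 𝒪[K] (fun A w => A.mulVec w) (fun A A' w => Matrix.add_mulVec A A' w)
      (fun c A w => Matrix.smul_mulVec c A w) (fun A w w' => Matrix.mulVec_add A w w')
      (fun c A w => Matrix.mulVec_smul A c w)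
  have hone := hv.isLattice_lat 1
  let L := Submodule.map₂ f (Subalgebra.toSubmodule D) (hv.lat 1)
  have hle : hv.lat 1 ≤ L := fun w hw => by
    have := Submodule.apply_mem_map₂ f (show 1 ∈ Subalgebra.toSubmodule D from one_mem D) hw
    simpa only [f, LinearMap.mk₂_apply, Matrix.one_mulVec] using this
  have hL : IsLattice L :=
    { fg := hD.1.1.map₂ f hone.fg
      span_eq_top := by
        rw [eq_top_iff, ← hone.span_eq_top]
        exact Submodule.span_mono hle
      mul_mem := by
        intro w hw b hb
        let T : (Fin 2 → B) →ₗ[𝒪[K]] (Fin 2 → B) :=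
          { toFun := fun w => MulOpposite.op b • w
            map_add' := smul_add _
            map_smul' := fun c w => smul_comm _ c w }
        have hT : L ≤ L.comap T := Submodule.map₂_le.mpr fun A hA w hw => by
          have : T (f A w) = f A (MulOpposite.op b • w) :=
            (Matrix.mulVec_smul A (MulOpposite.op b) w).symm
          rw [Submodule.mem_comap, this]
          exact Submodule.apply_mem_map₂ f hA (hone.mul_mem w hw b hb)
        exact hT hw }
  obtain ⟨g, hg⟩ := hv.exists_eq_lat hL
  refine ⟨g, hD.eq_of_le (hv.isFullOrder_ord g) fun A hA => ?_⟩
  rw [hv.isEndOf_lat g A, ← hg]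
  have hA' : L ≤ L.comap (f A) := Submodule.map₂_le.mpr fun A' hA' w hw => by
    have : f A (f A' w) = f (A * A') w := Matrix.mulVec_mulVec w A A'
    rw [Submodule.mem_comap, this]
    exact Submodule.apply_mem_map₂ f
      (show A * A' ∈ Subalgebra.toSubmodule D from D.mul_mem hA hA') hw
  exact fun w hw => hA' hw

end IsIntegerValuation

end Lattices

/-! ### Relative position of vertices and distances in the tree. -/

section Tree

variable {K : Type*} [Field K] [ValuativeRel K] {B : Type*} [DivisionRing B] [Algebra K B]
  {Γ : Type*} [LinearOrderedCommGroupWithZero Γ] {v : Valuation B Γ} {π : B}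

namespace IsIntegerValuation

theorem ord_mul_of_integralUnit (hv : IsIntegerValuation K v π)
    (g : (Matrix (Fin 2) (Fin 2) B)ˣ) {k : (Matrix (Fin 2) (Fin 2) B)ˣ} (hk : IntegralUnit v k) :
    hv.ord (g * k) = hv.ord g := by
  ext x
  rw [mem_ord, mem_ord, ← hk.matLE_conj_iff (x := g⁻¹.val * x * g.val)]
  simp only [mul_inv_rev, Units.val_mul, mul_assoc]

theorem ord_mul_scalarUnit (hv : IsIntegerValuation K v π)
    (g : (Matrix (Fin 2) (Fin 2) B)ˣ) (b : Bˣ) : hv.ord (g * scalarUnit b) = hv.ord g := by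
  ext x
  rw [mem_ord, mem_ord, ← matLE_scalarUnit_conj_iff (b := b) (x := g⁻¹.val * x * g.val)]
  simp only [mul_inv_rev, Units.val_mul, mul_assoc]

/-- The uniformizer as an invertible element. -/
def unif (hv : IsIntegerValuation K v π) : Bˣ := Units.mk0 π hv.ne_zero

@[simp]
theorem unif_val (hv : IsIntegerValuation K v π) : (hv.unif : B) = π := rfl

/-- The relative position of the lattices attached to `g` and `h`: the matrix `g⁻¹ * h` is
`k * diag(π ^ s, 1) * b * l` with `k` and `l` integral units. -/
theorem exists_relative_position (hv : IsIntegerValuation K v π)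
    (g h : (Matrix (Fin 2) (Fin 2) B)ˣ) :
    ∃ (k l : (Matrix (Fin 2) (Fin 2) B)ˣ) (s : ℕ) (b : Bˣ), IntegralUnit v k ∧ IntegralUnit v l ∧
      h = g * k * diagUnit hv.unif ^ s * scalarUnit b * l := by
  obtain ⟨k, l, a, b, hk, hl, ha, h1⟩ := exists_eq_integral_mul_diagonal (v := v) (g⁻¹ * h)
  obtain ⟨s, hs⟩ := hv.exists_pow a.ne_zero ha
  -- The diagonal entry `a` is a unit of 𝒪_B times πˢ; the unit is absorbed in `k`.
  have hu : v ((a * (hv.unif ^ s)⁻¹ : Bˣ) : B) = 1 := by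
    rw [Units.val_mul, Units.val_inv_eq_inv_val, map_mul, map_inv₀, hs, Units.val_pow_eq_pow_val,
      map_pow, unif_val]
    exact mul_inv_cancel₀ (pow_ne_zero _ hv.val_pos.ne')
  refine ⟨k * diagUnit (a * (hv.unif ^ s)⁻¹), l, s, b, hk.mul (integralUnit_diagUnit hu), hl, ?_⟩
  rw [inv_mul_eq_iff_eq_mul] at h1
  rw [h1, ← diagUnit_pow]
  have : diagUnit a = diagUnit (a * (hv.unif ^ s)⁻¹) * diagUnit (hv.unif ^ s) := by
    rw [← diagUnit_mul, inv_mul_cancel_right]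
  rw [this]
  simp only [mul_assoc]

/-- For `a` = π the upper right corner is the only entry whose valuation this conjugation can
increase, so it alone can obstruct integrality. -/
theorem conj_diagUnit_pow_apply (a : Bˣ) (s : ℕ) (x : Matrix (Fin 2) (Fin 2) B) :
    (((diagUnit a ^ s)⁻¹).val * x * (diagUnit a ^ s).val) 0 1 = ((a : B) ^ s)⁻¹ * x 0 1 := by
  rw [← diagUnit_pow]
  have h1 : (diagUnit (a ^ s)).val = Matrix.diagonal ![(a : B) ^ s, 1] := by
    rw [Matrix.diagonal_fin_two]
    simp [diagUnit]
  have h2 : (diagUnit (a ^ s))⁻¹.val = Matrix.diagonal ![((a : B) ^ s)⁻¹, 1] := by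
    rw [Matrix.diagonal_fin_two]
    change !![(((a ^ s)⁻¹ : Bˣ) : B), 0; 0, 1] = _
    simp
  rw [h1, h2, Matrix.mul_diagonal, Matrix.diagonal_mul]
  simp

/-- An order `g k diag(π ^ s, 1) M₂(𝒪_B) (…)⁻¹` containing `g π ^ t M₂(𝒪_B) g⁻¹` has `s ≤ t`. -/
theorem le_of_forall_mem_ord (hv : IsIntegerValuation K v π)
    {g k : (Matrix (Fin 2) (Fin 2) B)ˣ} (hk : IntegralUnit v k) {s t : ℕ}
    (h : ∀ x, MatLE v (v π ^ t) (g⁻¹.val * x * g.val) →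
      x ∈ hv.ord (g * k * diagUnit hv.unif ^ s)) : s ≤ t := by
  -- The test element has corner πᵗ in the basis `g * k`; integrality of π⁻ˢπᵗ is the inequality
  -- sought.
  have h1 := h ((g * k).val * Matrix.single 0 1 (π ^ t) * (g * k)⁻¹.val) (by
    have h2 : MatLE v (v π ^ t) (Matrix.single 0 1 (π ^ t)) := matLE_single (by rw [map_pow]) 0 1
    have h3 := (hk.1.mul h2).mul_of_le (δ := 1) (ε := v π ^ t) hk.2 (by simp)
    simpa [mul_assoc] using h3)
  have h2 : MatLE v 1 ((diagUnit hv.unif ^ s)⁻¹.val * Matrix.single 0 1 (π ^ t) *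
      (diagUnit hv.unif ^ s).val) := by
    rw [mem_ord] at h1
    simpa [mul_assoc] using h1
  have h3 := h2 0 1
  rw [conj_diagUnit_pow_apply, Matrix.single_apply_same, unif_val, map_mul, map_inv₀, map_pow,
    map_pow, inv_mul_le_one₀ (pow_pos hv.val_pos s)] at h3
  exact (pow_le_pow_iff_right_of_lt_one₀ hv.val_pos hv.lt_one).mp h3

/-- Equal orders are in relative position s = 0, so g⁻¹h is a scalar between two integral units; the
two bounds record this. -/
theorem exists_homothety (hv : IsIntegerValuation K v π) {g h : (Matrix (Fin 2) (Fin 2) B)ˣ}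
    (H : hv.ord g = hv.ord h) : ∃ b : Bˣ, MatLE v (v b) (g⁻¹.val * h.val) ∧
      MatLE v (v b)⁻¹ (h⁻¹.val * g.val) := by
  obtain ⟨k, l, s, b, hk, hl, rfl⟩ := hv.exists_relative_position g h
  rw [hv.ord_mul_of_integralUnit _ hl, hv.ord_mul_scalarUnit] at H
  have hs : s = 0 := Nat.le_zero.mp <| hv.le_of_forall_mem_ord hk (t := 0) fun x hx => by
    rw [← H, mem_ord]
    simpa using hx
  subst hs
  refine ⟨b, ?_, ?_⟩
  · have h1 := (hk.1.mul (matLE_scalar (le_refl (v (b : B))))).mul_of_le (ε := v (b : B)) hl.1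
      (by simp)
    simpa [mul_assoc, scalarUnit_val] using h1
  · have h1 := (hl.2.mul (matLE_scalar (le_refl (v ((b⁻¹ : Bˣ) : B))))).mul_of_le
      (ε := (v (b : B))⁻¹) hk.2 (by simp)
    simpa only [mul_inv_rev, Units.val_mul, pow_zero, mul_assoc, Units.inv_mul, mul_one,
      scalarUnit_inv, scalarUnit_val, one_mul] using h1

theorem latticeMulMaxIdeal_lat (hv : IsIntegerValuation K v π)
    (g : (Matrix (Fin 2) (Fin 2) B)ˣ) :
    latticeMulMaxIdeal (hv.lat g) = hv.lat (g * scalarUnit hv.unif) := by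
  have hmem : ∀ w, w ∈ hv.lat (g * scalarUnit hv.unif) ↔
      ∀ i, v ((g⁻¹.val.mulVec w) i) ≤ v π := by
    intro w
    rw [mem_lat]
    refine forall_congr' fun i => ?_
    have : (scalarUnit hv.unif)⁻¹.val = Matrix.diagonal fun _ : Fin 2 => π⁻¹ := by
      rw [scalarUnit_inv, scalarUnit_val, Matrix.scalar_apply, Units.val_inv_eq_inv_val, unif_val]
    rw [mul_inv_rev, Units.val_mul, ← Matrix.mulVec_mulVec, this, Matrix.mulVec_diagonal, map_mul,
      map_inv₀, inv_mul_le_one₀ hv.val_pos]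
  apply le_antisymm
  · refine Submodule.span_le.mpr ?_
    rintro _ ⟨w, hw, b, hb, rfl⟩
    rw [SetLike.mem_coe, hmem]
    intro i
    rw [Matrix.mulVec_smul, Pi.smul_apply, MulOpposite.smul_eq_mul_unop, map_mul]
    exact mul_le_of_le_one_of_le (hw i) (hv.le_of_lt_one (hv.mem_maxIdeal_iff.mp hb))
  · intro w hw
    rw [hmem] at hw
    refine Submodule.subset_span ⟨MulOpposite.op π⁻¹ • w, fun i => ?_, π,
      hv.mem_maxIdeal_iff.mpr hv.lt_one, ?_⟩
    · rw [Matrix.mulVec_smul, Pi.smul_apply, MulOpposite.smul_eq_mul_unop, map_mul,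
        MulOpposite.unop_op, map_inv₀]
      exact mul_inv_le_one_of_le₀ (hw i) zero_le
    · rw [smul_smul, ← MulOpposite.op_mul, inv_mul_cancel₀ hv.ne_zero, MulOpposite.op_one, one_smul]

/-- If two orders come from neighboring lattices, then representatives of the second one can be
chosen close to any representative of the first one. -/
theorem exists_near (hv : IsIntegerValuation K v π) {g g₁ g₂ : (Matrix (Fin 2) (Fin 2) B)ˣ}
    (h : hv.ord g = hv.ord g₁) {c : Bˣ} (h₁₂ : MatLE v (v c) (g₁⁻¹.val * g₂.val))
    (h₂₁ : MatLE v ((v c)⁻¹ * (v π)⁻¹) (g₂⁻¹.val * g₁.val)) :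
    ∃ g', hv.ord g' = hv.ord g₂ ∧ MatLE v 1 (g⁻¹.val * g'.val) ∧
      MatLE v (v π)⁻¹ (g'⁻¹.val * g.val) := by
  obtain ⟨b, hb, hb'⟩ := hv.exists_homothety h
  -- The scalar undoes both the homothety `b` from `g` to `g₁` and the scale `c` between `g₁` and
  -- `g₂`.
  refine ⟨g₂ * scalarUnit (b * c)⁻¹, hv.ord_mul_scalarUnit _ _, ?_, ?_⟩
  · rw [Units.val_mul, ← mul_assoc, matLE_mul_scalarUnit_iff]
    have h1 := hb.mul h₁₂
    rw [mul_assoc, Units.mul_inv_cancel_left] at h1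
    refine h1.mono (le_of_eq ?_)
    rw [Units.val_inv_eq_inv_val, map_inv₀, inv_inv, mul_one, Units.val_mul, map_mul]
  · rw [mul_inv_rev, scalarUnit_inv, inv_inv, Units.val_mul, mul_assoc, matLE_scalarUnit_mul_iff]
    have h1 := h₂₁.mul hb'
    rw [mul_assoc g₂⁻¹.val, Units.mul_inv_cancel_left] at h1
    refine h1.mono (le_of_eq ?_)
    rw [Units.val_mul, map_mul, mul_inv, mul_comm, mul_assoc]

theorem exists_near_of_adj (hv : IsIntegerValuation K v π) {D D' : Vertex K B}
    (hadj : (tree K B).Adj D D') {g : (Matrix (Fin 2) (Fin 2) B)ˣ} (hg : D.1 = hv.ord g) :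
    ∃ g', D'.1 = hv.ord g' ∧ MatLE v 1 (g⁻¹.val * g'.val) ∧
      MatLE v (v π)⁻¹ (g'⁻¹.val * g.val) := by
  have key : ∀ {E E' : Vertex K B}, (∃ L L' : Submodule 𝒪[K] (Fin 2 → B), IsLattice L ∧
      IsLattice L' ∧ IsEndOf E.1 L ∧ IsEndOf E'.1 L' ∧ latticeMulMaxIdeal L < L' ∧ L' < L) →
      ∃ g₁ g₂, E.1 = hv.ord g₁ ∧ E'.1 = hv.ord g₂ ∧ MatLE v 1 (g₁⁻¹.val * g₂.val) ∧
        MatLE v (v π)⁻¹ (g₂⁻¹.val * g₁.val) := by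
    rintro E E' ⟨L, L', hL, hL', hE, hE', h, h'⟩
    obtain ⟨g₁, rfl⟩ := hv.exists_eq_lat hL
    obtain ⟨g₂, rfl⟩ := hv.exists_eq_lat hL'
    refine ⟨g₁, g₂, hv.eq_ord_of_isEndOf hE, hv.eq_ord_of_isEndOf hE',
      hv.lat_le_lat_iff.mp h'.le, ?_⟩
    have h2 := h.le
    rw [latticeMulMaxIdeal_lat, lat_le_lat_iff, Units.val_mul, ← mul_assoc,
      matLE_mul_scalarUnit_iff, mul_one] at h2
    exact h2
  rw [tree, SimpleGraph.fromRel_adj] at hadj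
  rcases hadj.2 with h | h
  · obtain ⟨g₁, g₂, h₁, h₂, h₁₂, h₂₁⟩ := key h
    obtain ⟨g', hg', h⟩ := hv.exists_near (c := 1) (hg.symm.trans h₁) (by simpa using h₁₂)
      (by simpa using h₂₁)
    exact ⟨g', h₂.trans hg'.symm, h⟩
  -- Adjacency is symmetrized. Here Lπ ⊂ L' ⊂ L with L attached to `D'`; replacing L by Lπ, that is
  -- taking `c` = π⁻¹, restores the required inclusions.
  · obtain ⟨g₁, g₂, h₁, h₂, h₁₂, h₂₁⟩ := key h
    obtain ⟨g', hg', h⟩ := hv.exists_near (c := hv.unif⁻¹) (hg.symm.trans h₂) (by simpa using h₂₁)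
      (by simpa [hv.val_pos.ne'] using h₁₂)
    exact ⟨g', h₁.trans hg'.symm, h⟩

/-- In terms of lattices, a walk of length n from the vertex of L ends at the vertex of some L' with
Lπⁿ ⊆ L' ⊆ L; each edge costs one factor π. -/
theorem exists_near_of_walk (hv : IsIntegerValuation K v π) {D D' : Vertex K B}
    (p : (tree K B).Walk D D') {g : (Matrix (Fin 2) (Fin 2) B)ˣ} (hg : D.1 = hv.ord g) :
    ∃ g', D'.1 = hv.ord g' ∧ MatLE v 1 (g⁻¹.val * g'.val) ∧
      MatLE v (v π ^ p.length)⁻¹ (g'⁻¹.val * g.val) := by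
  induction p generalizing g with
  | nil => exact ⟨g, hg, by simpa using matLE_one, by simpa using matLE_one⟩
  | cons hadj p ih =>
    obtain ⟨g₁, hg₁, h₁, h₁'⟩ := hv.exists_near_of_adj hadj hg
    obtain ⟨g₂, hg₂, h₂, h₂'⟩ := ih hg₁
    refine ⟨g₂, hg₂, ?_, ?_⟩
    · have := h₁.mul_of_le (ε := 1) h₂ (by simp)
      rwa [mul_assoc, Units.mul_inv_cancel_left] at this
    · have := h₂'.mul h₁'
      rw [mul_assoc, Units.mul_inv_cancel_left] at this
      rwa [SimpleGraph.Walk.length_cons, pow_succ, mul_inv]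

variable [IsNoetherianRing 𝒪[K]]

/-- The vertex of the tree attached to an invertible matrix. -/
def vertex (hv : IsIntegerValuation K v π) (g : (Matrix (Fin 2) (Fin 2) B)ˣ) : Vertex K B :=
  ⟨hv.ord g, hv.isMaximalOrder_ord g⟩

/-- The lattice of g·diag(π, 1) lies strictly between Lπ and L, where L is that of g. A bound on the
distance suffices later, so the two vertices need not be shown distinct. -/
theorem edist_mul_diagUnit_le (hv : IsIntegerValuation K v π) (g : (Matrix (Fin 2) (Fin 2) B)ˣ) :
    (tree K B).edist (hv.vertex g) (hv.vertex (g * diagUnit hv.unif)) ≤ 1 := by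
  rw [SimpleGraph.edist_le_one_iff_adj_or_eq, or_iff_not_imp_right]
  intro hne
  rw [tree, SimpleGraph.fromRel_adj]
  refine ⟨hne, Or.inl ⟨hv.lat g, hv.lat (g * diagUnit hv.unif), hv.isLattice_lat _,
    hv.isLattice_lat _, hv.isEndOf_lat _, hv.isEndOf_lat _, ?_, ?_⟩⟩
  · rw [latticeMulMaxIdeal_lat, lt_iff_le_not_ge, lat_le_lat_iff, lat_le_lat_iff]
    have h1 : (g * diagUnit hv.unif)⁻¹.val * (g * scalarUnit hv.unif).val = !![1, 0; 0, π] := by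
      have : (diagUnit hv.unif)⁻¹.val = !![π⁻¹, 0; 0, 1] := rfl
      simp [this, scalarUnit_val, Matrix.diagonal_fin_two, hv.ne_zero]
    have h2 : (g * scalarUnit hv.unif)⁻¹.val * (g * diagUnit hv.unif).val =
        !![1, 0; 0, π⁻¹] := by
      simp [diagUnit, scalarUnit_inv, scalarUnit_val, Matrix.diagonal_fin_two,
        hv.ne_zero]
    rw [h1, h2]
    refine ⟨matLE_of (by simp) (by simp) (by simp) hv.lt_one.le, fun h => ?_⟩
    have := h 1 1
    simp only [Matrix.of_apply, Matrix.cons_val_one, Matrix.cons_val_fin_one, map_inv₀] at this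
    exact absurd this (not_le.mpr (one_lt_inv_iff₀.mpr ⟨hv.val_pos, hv.lt_one⟩))
  · rw [lt_iff_le_not_ge, lat_le_lat_iff, lat_le_lat_iff]
    have h1 : g⁻¹.val * (g * diagUnit hv.unif).val = !![π, 0; 0, 1] := by
      simp [diagUnit]
    have h2 : (g * diagUnit hv.unif)⁻¹.val * g.val = !![π⁻¹, 0; 0, 1] := by
      rw [mul_inv_rev, Units.val_mul, mul_assoc, Units.inv_mul, mul_one]
      rfl
    rw [h1, h2]
    refine ⟨matLE_of hv.lt_one.le (by simp) (by simp) (by simp), fun h => ?_⟩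
    have := h 0 0
    simp only [Matrix.of_apply, Matrix.cons_val_zero, map_inv₀] at this
    exact absurd this (not_le.mpr (one_lt_inv_iff₀.mpr ⟨hv.val_pos, hv.lt_one⟩))

theorem edist_mul_diagUnit_pow_le (hv : IsIntegerValuation K v π)
    (g : (Matrix (Fin 2) (Fin 2) B)ˣ) (s : ℕ) :
    (tree K B).edist (hv.vertex g) (hv.vertex (g * diagUnit hv.unif ^ s)) ≤ s := by
  induction s with
  | zero => simp
  | succ s ih =>
    refine (SimpleGraph.edist_triangle (v := hv.vertex (g * diagUnit hv.unif ^ s))).trans ?_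
    rw [pow_succ, ← mul_assoc, Nat.cast_add, Nat.cast_one]
    exact add_le_add ih (hv.edist_mul_diagUnit_le _)

end IsIntegerValuation

end Tree

/-! ### Powers of the maximal bilateral ideal, commutators and the ball. -/

section Bracket

variable {K : Type*} [Field K] [ValuativeRel K] {B : Type*} [DivisionRing B] [Algebra K B]
  {Γ : Type*} [LinearOrderedCommGroupWithZero Γ] {v : Valuation B Γ} {π : B}

namespace IsIntegerValuation

/-- The ideal `g π ^ n M₂(𝒪_B) g⁻¹` of the order `g M₂(𝒪_B) g⁻¹`. -/
def levelIdeal (hv : IsIntegerValuation K v π) (g : (Matrix (Fin 2) (Fin 2) B)ˣ) (n : ℕ) :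
    Ideal (hv.ord g) where
  carrier := {x | MatLE v (v π ^ n) (g⁻¹.val * x.1 * g.val)}
  add_mem' {x y} hx hy := by
    change MatLE v _ (g⁻¹.val * (x.1 + y.1) * g.val)
    rw [mul_add, add_mul]
    exact MatLE.add hx hy
  zero_mem' := by
    change MatLE v _ (g⁻¹.val * 0 * g.val)
    rw [mul_zero, zero_mul]
    exact matLE_zero
  smul_mem' a x hx := by
    have := (hv.mem_ord.mp a.2).mul_of_le (ε := v π ^ n) hx (by simp)
    simpa [mul_assoc] using this

theorem mem_levelIdeal (hv : IsIntegerValuation K v π) {g : (Matrix (Fin 2) (Fin 2) B)ˣ} {n : ℕ}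
    {x : hv.ord g} : x ∈ hv.levelIdeal g n ↔ MatLE v (v π ^ n) (g⁻¹.val * x.1 * g.val) := Iff.rfl

instance levelIdeal_isTwoSided (hv : IsIntegerValuation K v π)
    (g : (Matrix (Fin 2) (Fin 2) B)ˣ) (n : ℕ) : (hv.levelIdeal g n).IsTwoSided where
  mul_mem_of_left {x} a hx := by
    have := (hv.mem_levelIdeal.mp hx).mul_of_le (ε := v π ^ n) (hv.mem_ord.mp a.2) (by simp)
    rw [mem_levelIdeal]
    simpa [mul_assoc] using this

theorem levelIdeal_one_ne_top (hv : IsIntegerValuation K v π)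
    (g : (Matrix (Fin 2) (Fin 2) B)ˣ) : hv.levelIdeal g 1 ≠ ⊤ := by
  rw [Ideal.ne_top_iff_one, mem_levelIdeal]
  intro h
  have := h 0 0
  simp only [OneMemClass.coe_one, mul_one, Units.inv_mul, Matrix.one_apply_eq, map_one,
    pow_one] at this
  exact absurd this (not_le.mpr hv.lt_one)

/-- If an element of `J` had an entry of valuation 1, multiplying by matrix units and the inverse of
that entry would put the diagonal idempotents, hence 1, in `J`. -/
theorem le_levelIdeal_one (hv : IsIntegerValuation K v π) {g : (Matrix (Fin 2) (Fin 2) B)ˣ}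
    {J : Ideal (hv.ord g)} [J.IsTwoSided] (hJ : J ≠ ⊤) : J ≤ hv.levelIdeal g 1 := by
  intro x hx
  rw [mem_levelIdeal, pow_one]
  intro i j
  refine hv.le_of_lt_one (lt_of_le_of_ne (hv.mem_ord.mp x.2 i j) fun h1 => hJ ?_)
  set b := (g⁻¹.val * x.1 * g.val) i j with hb
  have hb0 : b ≠ 0 := by
    intro h0
    simp [h0] at h1
  have hmem : ∀ k l : Fin 2, ∀ c : B, v c ≤ 1 →
      g.val * Matrix.single k l c * g⁻¹.val ∈ hv.ord g := fun k l c hc => by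
    rw [mem_ord]
    simpa [mul_assoc] using matLE_single hc k l
  have hk : ∀ k : Fin 2, (⟨g.val * Matrix.single k k 1 * g⁻¹.val, hmem k k 1 (by simp)⟩ :
      hv.ord g) ∈ J := fun k => by
    have h2 : Matrix.single k k (1 : B) =
        Matrix.single k i b⁻¹ * (g⁻¹.val * x.1 * g.val) * Matrix.single j k 1 := by
      simp [← hb, hb0]
    have h3 : (⟨g.val * Matrix.single k k 1 * g⁻¹.val, hmem k k 1 (by simp)⟩ : hv.ord g) =
        ⟨g.val * Matrix.single k i b⁻¹ * g⁻¹.val, hmem k i b⁻¹ (by rw [map_inv₀, h1, inv_one])⟩ *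
          x * ⟨g.val * Matrix.single j k 1 * g⁻¹.val, hmem j k 1 (by simp)⟩ := by
      ext1
      change g.val * Matrix.single k k 1 * g⁻¹.val = g.val * Matrix.single k i b⁻¹ * g⁻¹.val *
        x.1 * (g.val * Matrix.single j k 1 * g⁻¹.val)
      rw [h2]
      simp only [mul_assoc]
    rw [h3]
    exact Ideal.mul_mem_right _ J (J.mul_mem_left _ hx)
  rw [Ideal.eq_top_iff_one]
  have h1 : (1 : hv.ord g) = ⟨g.val * Matrix.single 0 0 1 * g⁻¹.val, hmem 0 0 1 (by simp)⟩ +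
      ⟨g.val * Matrix.single 1 1 1 * g⁻¹.val, hmem 1 1 1 (by simp)⟩ := by
    ext1
    change (1 : Matrix (Fin 2) (Fin 2) B) = g.val * Matrix.single 0 0 1 * g⁻¹.val +
      g.val * Matrix.single 1 1 1 * g⁻¹.val
    have h2 : Matrix.single 0 0 (1 : B) + Matrix.single 1 1 1 =
        (1 : Matrix (Fin 2) (Fin 2) B) := by
      ext a c
      fin_cases a <;> fin_cases c <;> simp
    rw [← add_mul, ← mul_add, h2, mul_one, Units.mul_inv]
  rw [h1]
  exact add_mem (hk 0) (hk 1)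

theorem isMaximalBilateral_iff (hv : IsIntegerValuation K v π)
    {g : (Matrix (Fin 2) (Fin 2) B)ˣ} {I : Ideal (hv.ord g)} :
    IsMaximalBilateral I ↔ I = hv.levelIdeal g 1 := by
  have h1 : IsMaximalBilateral (hv.levelIdeal g 1) :=
    ⟨⟨inferInstance, hv.levelIdeal_one_ne_top g⟩, fun J hJ _ => by
      have := hJ.1
      exact hv.le_levelIdeal_one hJ.2⟩
  refine ⟨fun h => ?_, fun h => h ▸ h1⟩
  have := h.1.1
  exact h.eq_of_le h1.1 (hv.le_levelIdeal_one h.1.2)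

theorem maximalBilateral_ord (hv : IsIntegerValuation K v π) (g : (Matrix (Fin 2) (Fin 2) B)ˣ) :
    maximalBilateral (hv.ord g) = hv.levelIdeal g 1 := by
  have : {I : Ideal (hv.ord g) | IsMaximalBilateral I} = {hv.levelIdeal g 1} := by
    ext I
    exact hv.isMaximalBilateral_iff
  rw [maximalBilateral, this, sInf_singleton]

theorem levelIdeal_one_pow (hv : IsIntegerValuation K v π) (g : (Matrix (Fin 2) (Fin 2) B)ˣ)
    (n : ℕ) : hv.levelIdeal g 1 ^ n = hv.levelIdeal g n := by
  induction n with
  | zero =>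
    rw [Submodule.pow_zero, Ideal.one_eq_top, eq_comm, eq_top_iff]
    intro x _
    rw [mem_levelIdeal, pow_zero]
    exact hv.mem_ord.mp x.2
  | succ n ih =>
    rw [Submodule.pow_succ, ih]
    apply le_antisymm
    · refine Ideal.mul_le.mpr fun x hx y hy => ?_
      have := MatLE.mul (hv.mem_levelIdeal.mp hx) (hv.mem_levelIdeal.mp hy)
      rw [mem_levelIdeal, pow_succ]
      simpa [mul_assoc] using this
    · intro x hx
      rw [mem_levelIdeal] at hx
      -- A matrix divisible by πⁿ⁺¹ is split as (xπ⁻¹)·π in the basis `g`, with one factor in the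
      -- n-th power and one in the ideal itself.
      have hx' : MatLE v (v π ^ n)
          (g⁻¹.val * (x.1 * g.val * (scalarUnit hv.unif⁻¹).val * g⁻¹.val) * g.val) := by
        have : g⁻¹.val * (x.1 * g.val * (scalarUnit hv.unif⁻¹).val * g⁻¹.val) * g.val =
            g⁻¹.val * x.1 * g.val * (scalarUnit hv.unif⁻¹).val := by
          simp only [mul_assoc, Units.inv_mul, mul_one]
        rw [this, matLE_mul_scalarUnit_iff]
        refine hx.mono (le_of_eq ?_)
        rw [Units.val_inv_eq_inv_val, map_inv₀, inv_inv, pow_succ, unif_val, mul_comm]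
      have hp : MatLE v (v π ^ 1)
          (g⁻¹.val * (g.val * (scalarUnit hv.unif).val * g⁻¹.val) * g.val) := by
        have : g⁻¹.val * (g.val * (scalarUnit hv.unif).val * g⁻¹.val) * g.val =
            (scalarUnit hv.unif).val := by
          simp [mul_assoc]
        rw [this, pow_one]
        exact matLE_scalar le_rfl
      have hfac : x = (⟨_, hv.mem_ord.mpr (hx'.mono (pow_le_one' hv.lt_one.le n))⟩ : hv.ord g) *
          ⟨_, hv.mem_ord.mpr (hp.mono (pow_le_one' hv.lt_one.le 1))⟩ := by
        ext1
        change x.1 = x.1 * g.val * (scalarUnit hv.unif⁻¹).val * g⁻¹.val *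
          (g.val * (scalarUnit hv.unif).val * g⁻¹.val)
        rw [← scalarUnit_inv]
        simp [mul_assoc]
      rw [hfac]
      exact Ideal.mul_mem_mul hx' hp

theorem mem_bracket_iff (hv : IsIntegerValuation K v π) {g : (Matrix (Fin 2) (Fin 2) B)ˣ} {t : ℕ}
    {x : Matrix (Fin 2) (Fin 2) B} : x ∈ bracket (hv.ord g) t ↔
      MatLE v 1 (g⁻¹.val * x * g.val) ∧ ∀ z, MatLE v 1 z →
        MatLE v (v π ^ t) (g⁻¹.val * x * g.val * z - z * (g⁻¹.val * x * g.val)) := by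
  have hquot : ∀ a b : hv.ord g, (Ideal.Quotient.mk (maximalBilateral (hv.ord g) ^ t) a *
      Ideal.Quotient.mk (maximalBilateral (hv.ord g) ^ t) b =
      Ideal.Quotient.mk (maximalBilateral (hv.ord g) ^ t) b *
        Ideal.Quotient.mk (maximalBilateral (hv.ord g) ^ t) a) ↔
      MatLE v (v π ^ t) (g⁻¹.val * (a.1 * b.1 - b.1 * a.1) * g.val) := by
    intro a b
    rw [← map_mul, ← map_mul, Ideal.Quotient.mk_eq_mk_iff_sub_mem, maximalBilateral_ord,
      levelIdeal_one_pow]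
    rfl
  constructor
  · rintro ⟨hx, h⟩
    refine ⟨hv.mem_ord.mp hx, fun z hz => ?_⟩
    have hz' : g.val * z * g⁻¹.val ∈ hv.ord g := by
      rw [mem_ord]
      simpa [mul_assoc] using hz
    have h1 := (hquot ⟨x, hx⟩ ⟨_, hz'⟩).mp (Subring.mem_center_iff.mp h _).symm
    have h2 : g⁻¹.val * (x * (g.val * z * g⁻¹.val) - g.val * z * g⁻¹.val * x) * g.val =
        g⁻¹.val * x * g.val * z - z * (g⁻¹.val * x * g.val) := by
      simp [mul_sub, sub_mul, mul_assoc]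
    rwa [← h2]
  · rintro ⟨hx, h⟩
    refine ⟨hv.mem_ord.mpr hx, Subring.mem_center_iff.mpr fun q => ?_⟩
    obtain ⟨z, rfl⟩ := Ideal.Quotient.mk_surjective q
    refine ((hquot _ z).mpr ?_).symm
    have h2 : g⁻¹.val * (x * z.1 - z.1 * x) * g.val = g⁻¹.val * x * g.val *
        (g⁻¹.val * z.1 * g.val) - g⁻¹.val * z.1 * g.val * (g⁻¹.val * x * g.val) := by
      simp [mul_sub, sub_mul, mul_assoc]
    change MatLE v (v π ^ t) (g⁻¹.val * (x * z.1 - z.1 * x) * g.val)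
    rw [h2]
    exact h _ (hv.mem_ord.mp z.2)

/-- A matrix whose conjugates by integral units all have a small upper right corner is central up
to small matrices. -/
theorem matLE_commutator {γ : Γ} {y : Matrix (Fin 2) (Fin 2) B}
    (h : ∀ k, IntegralUnit v k → v ((k⁻¹.val * y * k.val) 0 1) ≤ γ)
    {z : Matrix (Fin 2) (Fin 2) B} (hz : MatLE v 1 z) : MatLE v γ (y * z - z * y) := by
  have h01 : v (y 0 1) ≤ γ := by simpa using h 1 integralUnit_one
  have h10 : v (y 1 0) ≤ γ := by
    have h1 := h (swapUnit B) integralUnit_swapUnit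
    have h2 : ((swapUnit B)⁻¹.val * y * (swapUnit B).val) 0 1 = y 1 0 := by
      change (!![0, 1; 1, 0] * y * !![0, 1; 1, 0] : Matrix (Fin 2) (Fin 2) B) 0 1 = y 1 0
      simp only [Matrix.mul_apply, Fin.sum_univ_two, Matrix.of_apply, Matrix.cons_val_zero,
        Matrix.cons_val_one, Matrix.cons_val_fin_one, zero_mul, one_mul, mul_zero, mul_one,
        zero_add, add_zero]
    rwa [h2] at h1
  -- Conjugation by the unipotent matrix of `b` brings this twisted difference into the corner, up
  -- to terms already bounded. The case b = 1 compares the diagonal entries; then the general case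
  -- shows that `a` almost commutes with 𝒪_B.
  have hb : ∀ b : B, v b ≤ 1 → v (y 0 0 * b - b * y 1 1) ≤ γ := by
    intro b hb
    have h1 := h (upperUnit b) (integralUnit_upperUnit hb)
    have h2 : ((upperUnit b)⁻¹.val * y * (upperUnit b).val) 0 1 =
        (y 0 0 * b - b * y 1 1) + (y 0 1 - b * y 1 0 * b) := by
      change (!![1, -b; 0, 1] * y * !![1, b; 0, 1] : Matrix (Fin 2) (Fin 2) B) 0 1 = _
      simp only [Matrix.mul_apply, Fin.sum_univ_two, Matrix.of_apply, Matrix.cons_val_zero,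
        Matrix.cons_val_one, Matrix.cons_val_fin_one]
      noncomm_ring
    rw [h2] at h1
    have h3 : v (y 0 1 - b * y 1 0 * b) ≤ γ := by
      refine v.map_sub_le h01 ?_
      rw [map_mul, map_mul]
      exact mul_le_of_le_of_le_one (mul_le_of_le_one_of_le hb h10) hb
    have h4 := v.map_sub_le h1 h3
    rwa [add_sub_cancel_right] at h4
  have hdiag : v (y 0 0 - y 1 1) ≤ γ := by simpa using hb 1 (by simp)
  set a := y 0 0 with ha
  have hab : ∀ b : B, v b ≤ 1 → v (a * b - b * a) ≤ γ := by
    intro b hb1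
    have h1 : a * b - b * a = (a * b - b * y 1 1) - b * (a - y 1 1) := by noncomm_ring
    rw [h1]
    refine v.map_sub_le (hb b hb1) ?_
    rw [map_mul]
    exact mul_le_of_le_one_of_le hb1 hdiag
  -- Thus `y` is the scalar `a` up to a small error, and the commutator splits accordingly.
  have hε : MatLE v γ (y - Matrix.scalar (Fin 2) a) := by
    rw [Matrix.eta_fin_two (y - Matrix.scalar (Fin 2) a)]
    refine matLE_of ?_ ?_ ?_ ?_
    · simp [ha]
    · simpa using h01
    · simpa using h10
    · have := v.map_sub_swap a (y 1 1)
      simpa [← this] using hdiag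
  have hdec : y * z - z * y = (Matrix.scalar (Fin 2) a * z - z * Matrix.scalar (Fin 2) a) +
      ((y - Matrix.scalar (Fin 2) a) * z - z * (y - Matrix.scalar (Fin 2) a)) := by noncomm_ring
  rw [hdec]
  refine MatLE.add (fun i j => ?_) ((hε.mul_of_le hz (by simp)).sub (hz.mul_of_le hε (by simp)))
  rw [Matrix.sub_apply, Matrix.scalar_apply, Matrix.diagonal_mul, Matrix.mul_diagonal]
  exact hab _ (hz i j)

variable [IsNoetherianRing 𝒪[K]]

theorem intersectionOrder_closedBall (hv : IsIntegerValuation K v π)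
    (g : (Matrix (Fin 2) (Fin 2) B)ˣ) (t : ℕ) :
    (intersectionOrder (closedBall (hv.vertex g) t) : Set (Matrix (Fin 2) (Fin 2) B)) =
      bracket (hv.ord g) t := by
  ext x
  have hmem : x ∈ intersectionOrder (closedBall (hv.vertex g) t) ↔
      ∀ D : Vertex K B, (tree K B).edist (hv.vertex g) D ≤ t → x ∈ D.1 := by
    simp only [intersectionOrder, Algebra.mem_iInf]
    rfl
  rw [SetLike.mem_coe, hmem, mem_bracket_iff]
  constructor
  · intro h
    refine ⟨hv.mem_ord.mp (h (hv.vertex g) (by simp)), fun z hz => matLE_commutator ?_ hz⟩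
    intro k hk
    have hd : (tree K B).edist (hv.vertex g) (hv.vertex (g * k * diagUnit hv.unif ^ t)) ≤ t := by
      have h1 : hv.vertex g = hv.vertex (g * k) :=
        Subtype.ext (hv.ord_mul_of_integralUnit g hk).symm
      rw [h1]
      exact hv.edist_mul_diagUnit_pow_le _ _
    have h2 := hv.mem_ord.mp (h _ hd) 0 1
    have h3 : (g * k * diagUnit hv.unif ^ t)⁻¹.val * x * (g * k * diagUnit hv.unif ^ t).val =
        (diagUnit hv.unif ^ t)⁻¹.val * (k⁻¹.val * (g⁻¹.val * x * g.val) * k.val) *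
          (diagUnit hv.unif ^ t).val := by
      simp only [mul_inv_rev, Units.val_mul, mul_assoc]
    rw [h3, conj_diagUnit_pow_apply, map_mul, map_inv₀, map_pow, unif_val,
      inv_mul_le_one₀ (pow_pos hv.val_pos t)] at h2
    exact h2
  · rintro ⟨hx, h⟩ D hD
    have hne : (tree K B).edist (hv.vertex g) D ≠ ⊤ :=
      (hD.trans_lt (ENat.natCast_lt_top t)).ne
    obtain ⟨p, hp⟩ := SimpleGraph.exists_walk_of_edist_ne_top hne
    have hpt : p.length ≤ t := by
      rw [← hp] at hD
      exact_mod_cast hD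
    obtain ⟨g', hg', h1, h2⟩ := hv.exists_near_of_walk p (g := g) rfl
    rw [hg', mem_ord]
    -- The denominator of g'⁻¹g, at most π to the length of the walk, is cancelled by the factor πᵗ
    -- in the commutator of g⁻¹xg with g⁻¹g'.
    have h3 := h2.mul_of_le (ε := 1) (h _ h1) (by
      rw [inv_mul_le_one₀ (pow_pos hv.val_pos _)]
      exact pow_le_pow_right_of_le_one' hv.lt_one.le hpt)
    have h4 := h3.add hx
    have h5 : g'⁻¹.val * g.val * (g⁻¹.val * x * g.val * (g⁻¹.val * g'.val) -
        g⁻¹.val * g'.val * (g⁻¹.val * x * g.val)) + g⁻¹.val * x * g.val =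
        g'⁻¹.val * x * g'.val := by
      simp [mul_sub, mul_assoc]
    rwa [h5] at h4

theorem edist_le_of_intersectionOrder_le (hv : IsIntegerValuation K v π)
    {g : (Matrix (Fin 2) (Fin 2) B)ˣ} {t : ℕ} {D : Vertex K B}
    (h : intersectionOrder (closedBall (hv.vertex g) t) ≤ D.1) :
    (tree K B).edist (hv.vertex g) D ≤ t := by
  obtain ⟨D, hD⟩ := D
  obtain ⟨g', rfl⟩ := hv.exists_eq_ord hD
  obtain ⟨k, l, s, b, hk, hl, rfl⟩ := hv.exists_relative_position g g'
  have hord : hv.ord (g * k * diagUnit hv.unif ^ s * scalarUnit b * l) =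
      hv.ord (g * k * diagUnit hv.unif ^ s) := by
    rw [hv.ord_mul_of_integralUnit _ hl, hv.ord_mul_scalarUnit]
  -- Matrices divisible by πᵗ in the basis `g` have commutators divisible by πᵗ, so they lie in the
  -- intersection and hence in `D`.
  have hst : s ≤ t := hv.le_of_forall_mem_ord hk fun x hx => by
    rw [← hord]
    refine h ?_
    rw [← SetLike.mem_coe, intersectionOrder_closedBall, mem_bracket_iff]
    exact ⟨hx.mono (pow_le_one' hv.lt_one.le t),
      fun z hz => (hx.mul_of_le hz (by simp)).sub (hz.mul_of_le hx (by simp))⟩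
  have h1 : hv.vertex g = hv.vertex (g * k) := Subtype.ext (hv.ord_mul_of_integralUnit g hk).symm
  have h2 : (⟨_, hD⟩ : Vertex K B) = hv.vertex (g * k * diagUnit hv.unif ^ s) := Subtype.ext hord
  rw [h1, h2]
  exact (hv.edist_mul_diagUnit_pow_le _ _).trans (by exact_mod_cast hst)

/-- The witness is the intersection of the ball itself: a submodule of the Noetherian module `hv.ord
g`, hence an order. -/
theorem isAdmissible_closedBall (hv : IsIntegerValuation K v π)
    (g : (Matrix (Fin 2) (Fin 2) B)ˣ) (t : ℕ) : IsAdmissible (closedBall (hv.vertex g) t) := by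
  refine ⟨intersectionOrder (closedBall (hv.vertex g) t), ?_, ?_⟩
  · have hfg := (hv.isFullOrder_ord g).1
    have : IsNoetherian 𝒪[K] (Subalgebra.toSubmodule (hv.ord g)) :=
      isNoetherian_of_fg_of_noetherian _ hfg
    refine Submodule.FG.of_le hfg fun x hx => ?_
    have hx' : x ∈ (intersectionOrder (closedBall (hv.vertex g) t) :
      Set (Matrix (Fin 2) (Fin 2) B)) := hx
    rw [intersectionOrder_closedBall] at hx'
    exact hx'.1
  · have : {D : Vertex K B | (tree K B).edist (hv.vertex g) D ≤ t} =
        {D | intersectionOrder (closedBall (hv.vertex g) t) ≤ D.1} := by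
      ext D
      exact ⟨fun h => iInf₂_le (f := fun (E : Vertex K B)
        (_ : E ∈ (closedBall (hv.vertex g) t).verts) => E.1) D h, hv.edist_le_of_intersectionOrder_le⟩
    rw [branch, ← this]
    rfl

end IsIntegerValuation

end Bracket

end BTTree

theorem mainTheorem6 {K : Type*} [Field K] [ValuativeRel K] [TopologicalSpace K]
    [IsNonarchimedeanLocalField K]
    {B : Type*} [DivisionRing B] [Algebra K B] [Algebra.IsCentral K B] [FiniteDimensional K B]
    (D : BTTree.Vertex K B) (t : ℕ) :
    -- `M_D` is the unique maximal bilateral ideal of `D`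
    (∀ I : Ideal D.1, BTTree.IsMaximalBilateral I ↔ I = BTTree.maximalBilateral D.1) ∧
    BTTree.IsAdmissible (BTTree.closedBall D t) ∧
    (BTTree.intersectionOrder (BTTree.closedBall D t) : Set (Matrix (Fin 2) (Fin 2) B)) =
      BTTree.bracket D.1 t := by
  obtain ⟨π, hv⟩ := BTTree.exists_isIntegerValuation K B
  obtain ⟨D, hD⟩ := D
  obtain ⟨g, rfl⟩ := hv.exists_eq_ord hD
  refine ⟨fun I => ?_, hv.isAdmissible_closedBall g t, hv.intersectionOrder_closedBall g t⟩
  rw [hv.maximalBilateral_ord]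
  exact hv.isMaximalBilateral_iff
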